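/- **Theorem 2.1.** Let $\alpha>0$ and $\nu>-1$ be real, and put $q=e^{-2\pi\alpha}$, $x=e^{-2\pi(1+\nu)\alpha}$ and $(x;q)_\infty=\prod_{n\ge 0}(1-xq^n)$, which is a positive real number. Then $$\log(x;q)_\infty=-\frac{\pi}{12\alpha}+\log\frac{\sqrt{2\pi}}{\Gamma(\nu+1)}+\frac{\pi}{12}\,\alpha-\Bigl(\nu+\frac12\Bigr)\log\frac{1-e^{-2\pi\nu\alpha}}{\nu}+\int_0^{\nu}\Bigl(\frac{2\pi\alpha t}{e^{2\pi\alpha t}-1}-1\Bigr)\,dt+M(\alpha,\nu),$$ where $$M(\alpha,\nu)=-\sum_{n=1}^\infty\frac{\cos 2n\pi\nu}{n\,(e^{2n\pi/\alpha}-1)}-\frac{2}{\pi}\,\mathcal{PV}\!\int_0^\infty\Bigl(\sum_{n=1}^\infty\frac{\sin 2n\nu\pi t}{n\,(e^{2n\pi t/\alpha}-1)}\Bigr)\frac{dt}{1-t^2},$$ both series converging absolutely (the second for every $t>0$). Here $\mathcal{PV}\int_0^\infty$ is the Cauchy principal value at the singularity $t=1$, namely $\lim_{\varepsilon\to0^+}\bigl(\int_0^{1-\varepsilon}+\int_{1+\varepsilon}^\infty\bigr)$,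 which exists. For $\nu=0$ the quotient $(1-e^{-2\pi\nu\alpha})/\nu$ is read as its limit $2\pi\alpha$, and at $t=0$ the integrand $2\pi\alpha t/(e^{2\pi\alpha t}-1)-1$ is read as its limit $0$. -/

import Mathlib

noncomputable section

/-- The infinite product `(x; q)_∞ = ∏_{n ≥ 0} (1 - x q ^ n)`. -/
def qPoch (x q : ℝ) : ℝ := ∏' n : ℕ, (1 - x * q ^ n)

/-- The set `s` with the open interval of radius `ε` around `c` removed. -/
def puncturedSet (s : Set ℝ) (c ε : ℝ) : Set ℝ := {t : ℝ | t ∈ s ∧ ε ≤ |t - c|}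

/-- `v` is the Cauchy principal value of the integral of `f` over `s`, singular at `c`:
`f` is Lebesgue integrable on `s` away from every symmetric neighbourhood of `c`, and
the integrals over `s \ (c - ε, c + ε)` converge to `v` as `ε → 0⁺`. -/
def HasPVIntegral (f : ℝ → ℝ) (s : Set ℝ) (c v : ℝ) : Prop :=
  (∀ ε : ℝ, 0 < ε → MeasureTheory.IntegrableOn f (puncturedSet s c ε)) ∧
    Filter.Tendsto (fun ε : ℝ => ∫ t in puncturedSet s c ε, f t)
      (nhdsWithin 0 (Set.Ioi 0)) (nhds v)

/-- The Cauchy principal value itself (meaningful when `HasPVIntegral f s c v` holds for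
some `v`, and then equal to `v`). -/
def pvIntegral (f : ℝ → ℝ) (s : Set ℝ) (c : ℝ) : ℝ :=
  Filter.limUnder (nhdsWithin (0 : ℝ) (Set.Ioi 0)) (fun ε : ℝ => ∫ t in puncturedSet s c ε, f t)

theorem HasPVIntegral.pvIntegral_eq {f : ℝ → ℝ} {s : Set ℝ} {c v : ℝ}
    (h : HasPVIntegral f s c v) : pvIntegral f s c = v :=
  h.2.limUnder_eq

/-- The term of index `n + 1` of the series `∑_{n ≥ 1} cos (2 n π ν) / (n (e^{2 n π / α} - 1))`. -/
def cosTerm (α ν : ℝ) (n : ℕ) : ℝ :=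
  Real.cos (2 * ((n : ℝ) + 1) * Real.pi * ν) /
    (((n : ℝ) + 1) * (Real.exp (2 * ((n : ℝ) + 1) * Real.pi / α) - 1))

/-- The term of index `n + 1` of the series
`∑_{n ≥ 1} sin (2 n ν π t) / (n (e^{2 n π t / α} - 1))`. -/
def sinTerm (α ν t : ℝ) (n : ℕ) : ℝ :=
  Real.sin (2 * ((n : ℝ) + 1) * ν * Real.pi * t) /
    (((n : ℝ) + 1) * (Real.exp (2 * ((n : ℝ) + 1) * Real.pi * t / α) - 1))

/-- The integrand of the singular integral in `M(α, ν)`. -/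
def singIntegrand (α ν t : ℝ) : ℝ := (∑' n : ℕ, sinTerm α ν t n) * (1 / (1 - t ^ 2))

/-- `M(α, ν)`. -/
def bigM (α ν : ℝ) : ℝ :=
  -(∑' n : ℕ, cosTerm α ν n)
    - (2 / Real.pi) * pvIntegral (singIntegrand α ν) (Set.Ioi 0) 1

/-- The function `ν ↦ (1 - e^{-2 π ν α}) / ν`, with its limit `2 π α` at the removable
singularity `ν = 0`. -/
def expQuot (α ν : ℝ) : ℝ :=
  if ν = 0 then 2 * Real.pi * α else (1 - Real.exp (-2 * Real.pi * ν * α)) / ν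

/-- The function `t ↦ 2 π α t / (e^{2 π α t} - 1) - 1`, with its limit `0` at the removable
singularity `t = 0`. -/
def bernIntegrand (α t : ℝ) : ℝ :=
  if t = 0 then 0 else 2 * Real.pi * α * t / (Real.exp (2 * Real.pi * α * t) - 1) - 1

end

/-! The right-hand side F(ν) (`logPochExpr`) satisfies F(ν) - F(ν+1) = log(1 - e^{-2πα(ν+1)}) and
F(ν+n) → 0, so telescoping yields F(ν) = ∑ log(1 - xqᵐ). Both facts rest on reading M(α,ν) as an
Euler–Maclaurin remainder.

Let L = log `expQuot`, Λ(s) = L(s) + παs and Ψ = Λ' (`bosePsi`). Then Ψ(s) = πα coth(παs) - 1/s is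
twice the sine transform of 1/(e^{v/α} - 1); it increases to πα on s > 0. For ω = 2πn, integrating
cos(ωst)cos(ω(s-ν)) over whole periods produces the factor 1/(1-t²). Hence the n-th principal value
integral is expressed by ∫ Ψ'(s) cos(ω(s-ν)) ds, and letting the interval grow leaves the cosine
term of M as the contribution of the pole t = 1 (`emRem_eq`). Summing gives -M = ∑ (2/ω²)(Ψ(ν) +
∫_ν^∞ Ψ' cos(ω(s-ν)) ds) (`hasSum_emRem`).

As ∑ (2/ω²) cos(ωx) is half the second Bernoulli polynomial on [0,1], M(ν+1) - M(ν) is the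
trapezoidal error of Λ on [ν,ν+1] (`bigM_add_one_sub`), which is the difference equation for F once
∫t·L' is integrated by parts. Since ∑ 2/ω² = 1/12, M → -πα/12 (`tendsto_bigM`); with Stirling's
formula and ζ(2) this gives F → 0. -/

open MeasureTheory Filter Set Topology

/-! ### Elementary bounds for the Bose kernel, and its geometric expansion. -/

/-- The Bose–Einstein kernel `1 / (e^{ct} - 1)`. -/
noncomputable def boseKernel (c t : ℝ) : ℝ := 1 / (Real.exp (c * t) - 1)

lemma exp_sub_one_pos {y : ℝ} (hy : 0 < y) : 0 < Real.exp y - 1 := by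
  have := Real.add_one_lt_exp hy.ne'
  linarith

lemma boseKernel_pos {c t : ℝ} (hc : 0 < c) (ht : 0 < t) : 0 < boseKernel c t :=
  one_div_pos.2 (exp_sub_one_pos (mul_pos hc ht))

/-- This is y/2 ≤ sinh(y/2) multiplied by 2e^{y/2}. It controls both the decay of the kernel and,
squared, the sign of `bosePsiDeriv`. -/
lemma self_mul_exp_half_le {y : ℝ} (hy : 0 ≤ y) : y * Real.exp (y / 2) ≤ Real.exp y - 1 := by
  have h : y / 2 ≤ Real.sinh (y / 2) := Real.self_le_sinh_iff.2 (by positivity)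
  rw [Real.sinh_eq] at h
  have h1 : Real.exp y = Real.exp (y / 2) * Real.exp (y / 2) := by
    rw [← Real.exp_add]; ring_nf
  have h2 : Real.exp (-(y / 2)) * Real.exp (y / 2) = 1 := by
    rw [← Real.exp_add]; simp
  have h3 : y ≤ Real.exp (y / 2) - Real.exp (-(y / 2)) := by linarith
  have := mul_le_mul_of_nonneg_right h3 (Real.exp_pos (y / 2)).le
  rw [sub_mul, h2, ← h1] at this
  exact this

lemma self_mul_boseKernel_le {c t : ℝ} (hc : 0 < c) (ht : 0 < t) :
    t * boseKernel c t ≤ 1 / c * Real.exp (-(c / 2) * t) := by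
  have h0 := exp_sub_one_pos (mul_pos hc ht)
  have h := self_mul_exp_half_le (mul_pos hc ht).le
  have h2 : Real.exp (-(c / 2) * t) * Real.exp (c * t / 2) = 1 := by
    rw [← Real.exp_add, ← Real.exp_zero]; congr 1; ring
  have he := Real.exp_pos (-(c / 2) * t)
  have h3 := mul_le_mul_of_nonneg_left h he.le
  have h4 : c * t ≤ Real.exp (-(c / 2) * t) * (Real.exp (c * t) - 1) := by
    calc c * t = Real.exp (-(c / 2) * t) * (c * t * Real.exp (c * t / 2)) := by
          linear_combination (-(c * t)) * h2
      _ ≤ _ := h3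
  unfold boseKernel
  rw [mul_one_div, div_le_iff₀ h0, one_div, mul_assoc, inv_mul_eq_div, le_div_iff₀ hc]
  linarith

lemma measurable_boseKernel (c : ℝ) : Measurable (boseKernel c) := by
  unfold boseKernel; fun_prop

lemma integrableOn_exp_half {c : ℝ} (hc : 0 < c) :
    IntegrableOn (fun t => 1 / c * Real.exp (-(c / 2) * t)) (Ioi 0) :=
  (integrableOn_exp_mul_Ioi (by linarith) 0).const_mul _

lemma integrableOn_self_mul_boseKernel {c : ℝ} (hc : 0 < c) :
    IntegrableOn (fun t => t * boseKernel c t) (Ioi 0) := by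
  refine Integrable.mono' (integrableOn_exp_half hc)
    (measurable_id.mul (measurable_boseKernel c)).aestronglyMeasurable ?_
  filter_upwards [ae_restrict_mem measurableSet_Ioi] with t ht
  rw [Real.norm_of_nonneg (mul_pos ht (boseKernel_pos hc ht)).le]
  exact self_mul_boseKernel_le hc ht

lemma abs_sin_mul_boseKernel_le {c t : ℝ} (b : ℝ) (hc : 0 < c) (ht : 0 < t) :
    |Real.sin (b * t) * boseKernel c t| ≤ |b| * (1 / c * Real.exp (-(c / 2) * t)) := by
  have hH := boseKernel_pos hc ht
  rw [abs_mul, abs_of_pos hH]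
  calc |Real.sin (b * t)| * boseKernel c t ≤ |b * t| * boseKernel c t := by
        exact mul_le_mul_of_nonneg_right Real.abs_sin_le_abs hH.le
    _ = |b| * (t * boseKernel c t) := by rw [abs_mul, abs_of_pos ht]; ring
    _ ≤ _ := mul_le_mul_of_nonneg_left (self_mul_boseKernel_le hc ht) (abs_nonneg b)

lemma integrableOn_sin_mul_boseKernel {c : ℝ} (b : ℝ) (hc : 0 < c) :
    IntegrableOn (fun t => Real.sin (b * t) * boseKernel c t) (Ioi 0) := by
  refine Integrable.mono' ((integrableOn_exp_half hc).const_mul |b|) ?_ ?_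
  · exact ((by fun_prop : Measurable fun t => Real.sin (b * t)).mul
      (measurable_boseKernel c)).aestronglyMeasurable
  filter_upwards [ae_restrict_mem measurableSet_Ioi] with t ht
  exact abs_sin_mul_boseKernel_le b hc ht

lemma hasSum_boseKernel {c t : ℝ} (hc : 0 < c) (ht : 0 < t) :
    HasSum (fun j : ℕ => Real.exp (-(c * (j + 1)) * t)) (boseKernel c t) := by
  have h1 : Real.exp (-(c * t)) < 1 := by
    rw [Real.exp_lt_one_iff]; nlinarith [mul_pos hc ht]
  have h := (hasSum_geometric_of_lt_one (Real.exp_pos _).le h1).mul_left (Real.exp (-(c * t)))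
  have hv : boseKernel c t = Real.exp (-(c * t)) * (1 - Real.exp (-(c * t)))⁻¹ := by
    unfold boseKernel
    rw [Real.exp_neg]
    have := exp_sub_one_pos (mul_pos hc ht)
    have h2 := Real.exp_pos (c * t)
    field_simp
  rw [hv]
  refine h.congr_fun fun j => ?_
  rw [← Real.exp_nat_mul, ← Real.exp_add]; congr 1; ring

/-! ### Sine transform and first moment of the Bose kernel. -/

lemma integral_id_mul_exp_neg {p : ℝ} (hp : 0 < p) :
    IntegrableOn (fun t : ℝ => t * Real.exp (-p * t)) (Ioi 0) ∧
    ∫ t in Ioi (0 : ℝ), t * Real.exp (-p * t) = 1 / p ^ 2 := by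
  constructor
  · have := integrableOn_rpow_mul_exp_neg_mul_rpow (s := 1) (p := 1) (b := p) (by norm_num)
      (by norm_num) hp
    simpa using this
  · have := Real.integral_rpow_mul_exp_neg_mul_Ioi (a := 2) (r := p) (by norm_num) hp
    norm_num at this
    simpa [Real.Gamma_two] using this

lemma integral_sin_mul_exp_neg {p : ℝ} (b : ℝ) (hp : 0 < p) :
    ∫ t in Ioi (0 : ℝ), Real.sin (b * t) * Real.exp (-p * t) = b / (b ^ 2 + p ^ 2) := by
  have hd : b ^ 2 + p ^ 2 ≠ 0 := by positivity
  have hder : ∀ t ∈ Ici (0 : ℝ), HasDerivAt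
      (fun t => -(Real.exp (-p * t) * (p * Real.sin (b * t) + b * Real.cos (b * t))) /
        (b ^ 2 + p ^ 2))
      (Real.sin (b * t) * Real.exp (-p * t)) t := by
    intro t _
    have e1 : HasDerivAt (fun t => Real.exp (-p * t)) (Real.exp (-p * t) * (-p)) t := by
      simpa using ((hasDerivAt_id t).const_mul (-p)).exp
    have e2 : HasDerivAt (fun t => Real.sin (b * t)) (Real.cos (b * t) * b) t := by
      simpa using ((hasDerivAt_id t).const_mul b).sin
    have e3 : HasDerivAt (fun t => Real.cos (b * t)) (-Real.sin (b * t) * b) t := by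
      simpa using ((hasDerivAt_id t).const_mul b).cos
    have := ((e1.mul ((e2.const_mul p).add (e3.const_mul b))).neg).div_const (b ^ 2 + p ^ 2)
    refine this.congr_deriv ?_
    dsimp only [Pi.add_apply]
    rw [div_eq_iff hd]
    ring
  have hint : IntegrableOn (fun t => Real.sin (b * t) * Real.exp (-p * t)) (Ioi 0) := by
    refine Integrable.mono' (integrableOn_exp_mul_Ioi (neg_lt_zero.2 hp) 0)
      (by fun_prop) (ae_of_all _ fun t => ?_)
    rw [norm_mul, Real.norm_of_nonneg (Real.exp_pos _).le, Real.norm_eq_abs]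
    exact mul_le_of_le_one_left (Real.exp_pos _).le (Real.abs_sin_le_one _)
  have hlim : Tendsto (fun t => -(Real.exp (-p * t) *
      (p * Real.sin (b * t) + b * Real.cos (b * t))) / (b ^ 2 + p ^ 2)) atTop (𝓝 0) := by
    have h0 : Tendsto (fun t => Real.exp (-p * t)) atTop (𝓝 0) :=
      Real.tendsto_exp_atBot.comp (tendsto_id.const_mul_atTop_of_neg (neg_lt_zero.2 hp))
    have h1 := h0.zero_mul_isBoundedUnder_le
      (g := fun t => p * Real.sin (b * t) + b * Real.cos (b * t))
      ⟨|p| + |b|, eventually_map.2 (Eventually.of_forall fun t => by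
        simp only [Function.comp, Real.norm_eq_abs]
        refine (abs_add_le _ _).trans (add_le_add ?_ ?_) <;> rw [abs_mul]
        · exact mul_le_of_le_one_right (abs_nonneg _) (Real.abs_sin_le_one _)
        · exact mul_le_of_le_one_right (abs_nonneg _) (Real.abs_cos_le_one _))⟩
    simpa using h1.neg.div_const (b ^ 2 + p ^ 2)
  rw [integral_Ioi_of_hasDerivAt_of_tendsto' hder hint hlim]
  simp
  field_simp

lemma summable_one_div_mul_succ_sq (c : ℝ) :
    Summable (fun j : ℕ => 1 / (c * ((j : ℝ) + 1)) ^ 2) := by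
  have h : Summable (fun j : ℕ => 1 / ((j : ℝ) + 1) ^ 2) := by
    have := (summable_nat_add_iff 1).2 (Real.summable_one_div_nat_pow.2 (by norm_num : 1 < 2))
    simpa using this
  refine (h.mul_left (1 / c ^ 2)).congr fun j => ?_
  rw [mul_pow, one_div_mul_one_div]

/-- Termwise integration of the geometric series. The bound linear in t makes the L¹ norms at most
C/(c(j+1))², hence summable; mere boundedness of g would only give a harmonic series. -/
lemma integral_mul_boseKernel_hasSum {c C : ℝ} (hc : 0 < c) {g : ℝ → ℝ} (hg : Measurable g)
    (hb : ∀ t, 0 < t → |g t| ≤ C * t) :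
    HasSum (fun j : ℕ => ∫ t in Ioi (0 : ℝ), g t * Real.exp (-(c * (j + 1)) * t))
      (∫ t in Ioi (0 : ℝ), g t * boseKernel c t) := by
  have hp : ∀ j : ℕ, 0 < c * ((j : ℝ) + 1) := fun j => by positivity
  have hle : ∀ j : ℕ, ∀ᵐ t ∂(volume.restrict (Ioi (0 : ℝ))),
      ‖g t * Real.exp (-(c * (j + 1)) * t)‖ ≤ C * (t * Real.exp (-(c * (j + 1)) * t)) := by
    intro j
    filter_upwards [ae_restrict_mem measurableSet_Ioi] with t ht
    rw [norm_mul, Real.norm_of_nonneg (Real.exp_pos _).le, Real.norm_eq_abs, ← mul_assoc]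
    exact mul_le_mul_of_nonneg_right (hb t ht) (Real.exp_pos _).le
  have hint : ∀ j : ℕ, IntegrableOn (fun t => g t * Real.exp (-(c * (j + 1)) * t)) (Ioi 0) :=
    fun j => Integrable.mono' ((integral_id_mul_exp_neg (hp j)).1.const_mul C)
      (hg.mul (by fun_prop : Measurable fun t =>
        Real.exp (-(c * (j + 1)) * t))).aestronglyMeasurable (hle j)
  have hsum : Summable fun j : ℕ => ∫ t in Ioi (0 : ℝ), ‖g t * Real.exp (-(c * (j + 1)) * t)‖ := by
    refine Summable.of_nonneg_of_le (fun j => integral_nonneg fun _ => norm_nonneg _) (fun j => ?_)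
      ((summable_one_div_mul_succ_sq c).mul_left C)
    calc _ ≤ ∫ t in Ioi (0 : ℝ), C * (t * Real.exp (-(c * (j + 1)) * t)) :=
          integral_mono_ae (hint j).norm ((integral_id_mul_exp_neg (hp j)).1.const_mul C) (hle j)
      _ = _ := by rw [integral_const_mul, (integral_id_mul_exp_neg (hp j)).2]
  have h := hasSum_integral_of_summable_integral_norm hint hsum
  have hv : ∫ t in Ioi (0 : ℝ), g t * boseKernel c t =
      ∫ t in Ioi (0 : ℝ), ∑' j : ℕ, g t * Real.exp (-(c * (j + 1)) * t) := by
    refine setIntegral_congr_fun (measurableSet_Ioi (a := (0 : ℝ))) fun t ht => ?_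
    exact ((hasSum_boseKernel hc ht).mul_left (g t)).tsum_eq.symm
  rw [hv]
  exact h
  

/-- The Mittag-Leffler expansion of π cot(πz) at the non-integer point z = iy, divided by -i. -/
lemma hasSum_coth {y : ℝ} (hy : y ≠ 0) :
    HasSum (fun j : ℕ => 2 * y / (y ^ 2 + ((j : ℝ) + 1) ^ 2))
      (Real.pi + 2 * Real.pi / (Real.exp (2 * Real.pi * y) - 1) - 1 / y) := by
  have hz : (Complex.I * y : ℂ) ∈ Complex.integerComplement := by
    rintro ⟨n, hn⟩
    have := congrArg Complex.im hn
    simp at this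
    exact hy this.symm
  have hrep := cot_series_rep' hz
  have hterm : ∀ j : ℕ, (1 / (Complex.I * y - (j + 1)) + 1 / (Complex.I * y + (j + 1)) : ℂ)
      = -Complex.I * ((2 * y / (y ^ 2 + ((j : ℝ) + 1) ^ 2) : ℝ) : ℂ) := by
    intro j
    have h1 : (Complex.I * y - (j + 1) : ℂ) ≠ 0 := by
      intro h; have := congrArg Complex.im h; simp at this; exact hy this
    have h2 : (Complex.I * y + (j + 1) : ℂ) ≠ 0 := by
      intro h; have := congrArg Complex.im h; simp at this; exact hy this
    have h3 : ((y : ℂ) ^ 2 + ((j : ℂ) + 1) ^ 2) ≠ 0 := by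
      have : (y ^ 2 + ((j : ℝ) + 1) ^ 2) ≠ 0 := by positivity
      exact_mod_cast this
    push_cast
    rw [div_add_div _ _ h1 h2, mul_div_assoc', div_eq_div_iff (mul_ne_zero h1 h2) h3]
    ring_nf
    simp only [show Complex.I ^ 3 = -Complex.I by
      rw [pow_succ, Complex.I_sq]; ring]
    ring
  have hs : Summable fun j : ℕ => 2 * y / (y ^ 2 + ((j : ℝ) + 1) ^ 2) := by
    refine Summable.of_norm_bounded ((summable_one_div_mul_succ_sq 1).mul_left |2 * y|) fun j => ?_
    rw [norm_div, Real.norm_eq_abs, Real.norm_of_nonneg (by positivity), mul_one_div, one_mul]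
    gcongr
    nlinarith [sq_nonneg y]
  simp_rw [hterm] at hrep
  rw [tsum_mul_left, ← Complex.ofReal_tsum] at hrep
  have hval : (∑' j : ℕ, 2 * y / (y ^ 2 + ((j : ℝ) + 1) ^ 2)) =
      Real.pi + 2 * Real.pi / (Real.exp (2 * Real.pi * y) - 1) - 1 / y := by
    rw [Complex.cot_pi_eq_exp_ratio] at hrep
    have hE : Complex.exp (2 * Real.pi * Complex.I * (Complex.I * y)) =
        ((Real.exp (2 * Real.pi * y))⁻¹ : ℝ) := by
      rw [← Real.exp_neg]; push_cast; congr 1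
      linear_combination (2 * Real.pi * y : ℂ) * Complex.I_mul_I
    rw [hE] at hrep
    have hne : Real.exp (2 * Real.pi * y) - 1 ≠ 0 := by
      rw [sub_ne_zero, Ne, Real.exp_eq_one_iff]; positivity
    have hy' : (y : ℂ) ≠ 0 := by exact_mod_cast hy
    apply Complex.ofReal_injective
    have hI : ((∑' j : ℕ, 2 * y / (y ^ 2 + ((j : ℝ) + 1) ^ 2) : ℝ) : ℂ) = Complex.I *
      (-Complex.I * ((∑' j : ℕ, 2 * y / (y ^ 2 + ((j : ℝ) + 1) ^ 2) : ℝ) : ℂ)) := by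
      rw [← mul_assoc, mul_neg, Complex.I_mul_I]; simp
    have key : ∀ w : ℂ, w ≠ 0 → w - 1 ≠ 0 →
        Complex.I * (Real.pi * ((w⁻¹ + 1) / (Complex.I * (1 - w⁻¹))) - 1 / (Complex.I * y)) =
        Real.pi + 2 * Real.pi / (w - 1) - 1 / y := by
      intro w hw hw1
      have hI0 := Complex.I_ne_zero
      field_simp
      ring
    have hk := key (Real.exp (2 * Real.pi * y) : ℝ) (by exact_mod_cast (Real.exp_pos _).ne')
      (by exact_mod_cast hne)
    rw [← Complex.ofReal_inv] at hk
    rw [hI, ← hrep, hk]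
    push_cast
    rfl
  exact hval ▸ hs.hasSum

lemma integral_sin_mul_boseKernel {b c : ℝ} (hb : b ≠ 0) (hc : 0 < c) :
    ∫ t in Ioi (0 : ℝ), Real.sin (b * t) * boseKernel c t =
      1 / (2 * c) * (Real.pi + 2 * Real.pi / (Real.exp (2 * Real.pi * (b / c)) - 1) - c / b) := by
  have h := integral_mul_boseKernel_hasSum hc (C := |b|) (g := fun t => Real.sin (b * t))
    (by fun_prop) (fun t ht => by
      calc _ ≤ |b * t| := Real.abs_sin_le_abs
        _ = _ := by rw [abs_mul, abs_of_pos ht])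
  have h2 := (hasSum_coth (div_ne_zero hb hc.ne')).mul_left (1 / (2 * c))
  rw [show 1 / (b / c) = c / b by rw [one_div_div]] at h2
  refine h.unique (h2.congr_fun fun j => ?_)
  rw [integral_sin_mul_exp_neg b (by positivity)]
  field_simp

lemma integral_id_mul_boseKernel {c : ℝ} (hc : 0 < c) :
    ∫ t in Ioi (0 : ℝ), t * boseKernel c t = Real.pi ^ 2 / (6 * c ^ 2) := by
  have h := integral_mul_boseKernel_hasSum hc (C := 1) (g := fun t => t)
    (by fun_prop) (fun t ht => by rw [abs_of_pos ht, one_mul])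
  have h2 := ((hasSum_nat_add_iff' 1).2 hasSum_zeta_two).mul_left (1 / c ^ 2)
  have hv : Real.pi ^ 2 / (6 * c ^ 2) =
      1 / c ^ 2 * (Real.pi ^ 2 / 6 - ∑ i ∈ Finset.range 1, 1 / (i : ℝ) ^ 2) := by
    simp
    field_simp
  rw [hv]
  refine h.unique (h2.congr_fun fun j => ?_)
  rw [(integral_id_mul_exp_neg (by positivity)).2]
  push_cast
  rw [mul_pow, one_div_mul_one_div]

/-! ### The function Ψ = `bosePsi`: closed form, limit, monotonicity. -/

/-- The odd function `s ↦ πα coth (παs) - 1/s`, given as a sine transform. -/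
noncomputable def bosePsi (α s : ℝ) : ℝ :=
  2 * ∫ v in Ioi (0 : ℝ), Real.sin (s * v) * boseKernel (1 / α) v

/-- The derivative of `bosePsi α`, given as a cosine transform. -/
noncomputable def bosePsiDeriv (α s : ℝ) : ℝ :=
  2 * ∫ v in Ioi (0 : ℝ), Real.cos (s * v) * (v * boseKernel (1 / α) v)

lemma measurable_id_mul_boseKernel (c : ℝ) : Measurable fun v => v * boseKernel c v :=
  measurable_id.mul (measurable_boseKernel c)

lemma abs_cos_mul_boseKernel_le {c v : ℝ} (hc : 0 < c) (hv : 0 < v) (b : ℝ) :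
    |Real.cos b * (v * boseKernel c v)| ≤ v * boseKernel c v := by
  have h := (mul_pos hv (boseKernel_pos hc hv)).le
  rw [abs_mul, abs_of_nonneg h]
  exact mul_le_of_le_one_left h (Real.abs_cos_le_one _)

lemma integrableOn_cos_mul_boseKernel {c : ℝ} (hc : 0 < c) (b : ℝ) :
    IntegrableOn (fun v => Real.cos (b * v) * (v * boseKernel c v)) (Ioi 0) := by
  refine Integrable.mono' (integrableOn_self_mul_boseKernel hc)
    ((by fun_prop : Measurable fun v => Real.cos (b * v)).mul
      (measurable_id_mul_boseKernel c)).aestronglyMeasurable ?_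
  filter_upwards [ae_restrict_mem measurableSet_Ioi] with v hv
  exact abs_cos_mul_boseKernel_le hc hv _

lemma hasDerivAt_bosePsi {α : ℝ} (hα : 0 < α) (s : ℝ) :
    HasDerivAt (bosePsi α) (bosePsiDeriv α s) s := by
  have hc : 0 < 1 / α := by positivity
  have h := hasDerivAt_integral_of_dominated_loc_of_deriv_le
    (μ := volume.restrict (Ioi (0 : ℝ))) (s := univ) (x₀ := s)
    (F := fun s v => Real.sin (s * v) * boseKernel (1 / α) v)
    (F' := fun s v => Real.cos (s * v) * (v * boseKernel (1 / α) v))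
    (bound := fun v => v * boseKernel (1 / α) v) univ_mem
    (Eventually.of_forall fun s => (integrableOn_sin_mul_boseKernel s hc).aestronglyMeasurable)
    (integrableOn_sin_mul_boseKernel s hc)
    (integrableOn_cos_mul_boseKernel hc s).aestronglyMeasurable
    (by
      filter_upwards [ae_restrict_mem measurableSet_Ioi] with v hv x _
      exact abs_cos_mul_boseKernel_le hc hv _)
    (integrableOn_self_mul_boseKernel hc)
    (ae_of_all _ fun v x _ => by
      have := (((hasDerivAt_id x).mul_const v).sin).mul_const (boseKernel (1 / α) v)
      refine this.congr_deriv ?_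
      simp only [id, one_mul]
      ring)
  exact h.2.const_mul 2

lemma continuous_bosePsi {α : ℝ} (hα : 0 < α) : Continuous (bosePsi α) :=
  continuous_iff_continuousAt.2 fun s => (hasDerivAt_bosePsi hα s).continuousAt

lemma continuous_bosePsiDeriv {α : ℝ} (hα : 0 < α) : Continuous (bosePsiDeriv α) := by
  have hc : 0 < 1 / α := by positivity
  refine continuous_const.mul (continuous_of_dominated
    (fun s => (integrableOn_cos_mul_boseKernel hc s).aestronglyMeasurable)
    (fun s => ?_) (integrableOn_self_mul_boseKernel hc) (ae_of_all _ fun v => by fun_prop))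
  filter_upwards [ae_restrict_mem measurableSet_Ioi] with v hv
  exact abs_cos_mul_boseKernel_le hc hv _

lemma bosePsi_eq {α s : ℝ} (hα : 0 < α) (hs : s ≠ 0) :
    bosePsi α s = Real.pi * α + 2 * Real.pi * α / (Real.exp (2 * Real.pi * α * s) - 1) - 1 / s := by
  unfold bosePsi
  rw [integral_sin_mul_boseKernel hs (by positivity),
    show 2 * Real.pi * (s / (1 / α)) = 2 * Real.pi * α * s by field_simp]
  field_simp

lemma tendsto_const_div_exp_sub_one (b : ℝ) {c : ℝ} (hc : 0 < c) :
    Tendsto (fun s => b / (Real.exp (c * s) - 1)) atTop (𝓝 0) :=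
  tendsto_const_nhds.div_atTop (tendsto_atTop_add_const_right _ (-1)
    (Real.tendsto_exp_atTop.comp (tendsto_id.const_mul_atTop hc)))

lemma tendsto_bosePsi {α : ℝ} (hα : 0 < α) :
    Tendsto (bosePsi α) atTop (𝓝 (Real.pi * α)) := by
  have h := ((tendsto_const_div_exp_sub_one (2 * Real.pi * α)
    (c := 2 * Real.pi * α) (by positivity)).const_add (Real.pi * α)).sub
    (tendsto_const_nhds.div_atTop (a := (1 : ℝ)) tendsto_id)
  simp only [add_zero, sub_zero] at h
  refine h.congr' ?_
  filter_upwards [eventually_gt_atTop 0] with s hs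
  rw [bosePsi_eq hα hs.ne', id]

/-- Differentiating the closed form gives 1/s² - a²e^{as}/(e^{as}-1)² with a = 2πα; its sign is the
square of `self_mul_exp_half_le`. -/
lemma bosePsiDeriv_nonneg {α s : ℝ} (hα : 0 < α) (hs : 0 < s) : 0 ≤ bosePsiDeriv α s := by
  set a := 2 * Real.pi * α with ha
  have ha0 : 0 < a := by positivity
  have hE := exp_sub_one_pos (mul_pos ha0 hs)
  have h1 : HasDerivAt (fun s => Real.pi * α + a / (Real.exp (a * s) - 1) - 1 / s)
      (-(a * (Real.exp (a * s) * a)) / (Real.exp (a * s) - 1) ^ 2 + 1 / s ^ 2) s := by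
    have e1 : HasDerivAt (fun s => Real.exp (a * s) - 1) (Real.exp (a * s) * a) s := by
      simpa using (((hasDerivAt_id s).const_mul a).exp).sub_const 1
    have e2 := ((hasDerivAt_const s a).div e1 hE.ne').const_add (Real.pi * α)
    have e3 := e2.sub (hasDerivAt_inv hs.ne')
    simp only [one_div]
    refine e3.congr_deriv ?_
    simp
  have h2 : HasDerivAt (bosePsi α)
      (-(a * (Real.exp (a * s) * a)) / (Real.exp (a * s) - 1) ^ 2 + 1 / s ^ 2) s := by
    refine h1.congr_of_eventuallyEq ?_
    filter_upwards [eventually_ne_nhds hs.ne'] with x hx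
    rw [bosePsi_eq hα hx]
  rw [(hasDerivAt_bosePsi hα s).unique h2]
  have h3 := self_mul_exp_half_le (mul_pos ha0 hs).le
  have h4 : (a * s) ^ 2 * Real.exp (a * s) ≤ (Real.exp (a * s) - 1) ^ 2 := by
    calc (a * s) ^ 2 * Real.exp (a * s) = (a * s * Real.exp (a * s / 2)) ^ 2 := by
          rw [mul_pow (a * s) (Real.exp _), ← Real.exp_nat_mul]; congr 2; push_cast; ring
      _ ≤ _ := by gcongr
  have h5 : a * (Real.exp (a * s) * a) / (Real.exp (a * s) - 1) ^ 2 ≤ 1 / s ^ 2 := by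
    rw [div_le_div_iff₀ (by positivity) (by positivity)]
    nlinarith
  rw [neg_div]
  linarith

/-- On the positive axis a nonnegative derivative of a function with a finite limit is integrable;
for ν < 0 continuity covers the remaining bounded piece. -/
lemma integrableOn_bosePsiDeriv {α : ℝ} (hα : 0 < α) (ν : ℝ) :
    IntegrableOn (bosePsiDeriv α) (Ioi ν) := by
  have h0 : IntegrableOn (bosePsiDeriv α) (Ioi (max ν 0)) :=
    integrableOn_Ioi_deriv_of_nonneg' (fun x _ => hasDerivAt_bosePsi hα x)
      (fun x hx => bosePsiDeriv_nonneg hα (lt_of_le_of_lt (le_max_right _ _) hx))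
      (tendsto_bosePsi hα)
  rw [← Ioc_union_Ioi_eq_Ioi (le_max_left ν 0)]
  exact (((continuous_bosePsiDeriv hα).integrableOn_Icc).mono_set Ioc_subset_Icc_self).union h0

lemma integral_Ioi_bosePsiDeriv {α : ℝ} (hα : 0 < α) (ν : ℝ) :
    ∫ s in Ioi ν, bosePsiDeriv α s = Real.pi * α - bosePsi α ν :=
  integral_Ioi_of_hasDerivAt_of_tendsto' (fun x _ => hasDerivAt_bosePsi hα x)
    (integrableOn_bosePsiDeriv hα ν) (tendsto_bosePsi hα)

lemma boseKernel_scale (ω α t : ℝ) : boseKernel (ω / α) t = boseKernel (1 / α) (ω * t) := by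
  unfold boseKernel
  rw [show ω / α * t = 1 / α * (ω * t) by ring]

/-- The substitution v = ωt brings in the kernel of rate ω/α, the one occurring in the series of M.
-/
lemma bosePsi_scale {ω : ℝ} (α s : ℝ) (hω : 0 < ω) :
    bosePsi α s = 2 * ω * ∫ t in Ioi (0 : ℝ), Real.sin (ω * s * t) * boseKernel (ω / α) t := by
  have h := integral_comp_mul_left_Ioi (fun v => Real.sin (s * v) * boseKernel (1 / α) v) 0 hω
  rw [mul_zero] at h
  unfold bosePsi
  have h2 : ∀ t, Real.sin (ω * s * t) * boseKernel (ω / α) t =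
      Real.sin (s * (ω * t)) * boseKernel (1 / α) (ω * t) := by
    intro t
    rw [boseKernel_scale, show ω * s * t = s * (ω * t) by ring]
  simp_rw [h2]
  rw [h, smul_eq_mul]
  field_simp

lemma bosePsiDeriv_scale {ω : ℝ} (α s : ℝ) (hω : 0 < ω) :
    bosePsiDeriv α s = 2 * ω ^ 2 *
      ∫ t in Ioi (0 : ℝ), Real.cos (ω * s * t) * (t * boseKernel (ω / α) t) := by
  have h := integral_comp_mul_left_Ioi
    (fun v => Real.cos (s * v) * (v * boseKernel (1 / α) v)) 0 hω
  rw [mul_zero] at h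
  unfold bosePsiDeriv
  have h2 : ∀ t, Real.cos (ω * s * t) * (t * boseKernel (ω / α) t) =
      ω⁻¹ * (Real.cos (s * (ω * t)) * (ω * t * boseKernel (1 / α) (ω * t))) := by
    intro t
    rw [boseKernel_scale, show ω * s * t = s * (ω * t) by ring]
    field_simp
  simp_rw [h2]
  rw [integral_const_mul, h, smul_eq_mul]
  field_simp

/-! ### The Riemann–Lebesgue lemma and the Dirichlet integral. -/

lemma tendsto_integral_mul_sin {f : ℝ → ℝ} (hf : Integrable f) :
    Tendsto (fun w => ∫ t, f t * Real.sin (w * t)) atTop (𝓝 0) := by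
  have h := (Real.tendsto_integral_exp_smul_cocompact (fun t => (f t : ℂ)))
  have h2 : Tendsto (fun w : ℝ => w / (2 * Real.pi)) atTop (cocompact ℝ) :=
    (tendsto_id.atTop_div_const (by positivity)).mono_right atTop_le_cocompact
  have h3 := (Complex.continuous_im.tendsto _).comp (h.comp h2)
  simp only [Complex.zero_im] at h3
  rw [← neg_zero]
  refine (h3.neg).congr fun w => ?_
  have hi : Integrable fun t : ℝ => Real.fourierChar (-(t * (w / (2 * Real.pi)))) • (f t : ℂ) := by
    refine hf.ofReal.mono ?_ (ae_of_all _ fun t => (Circle.norm_smul _ _).le)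
    exact (Continuous.aestronglyMeasurable (by fun_prop)).smul hf.ofReal.aestronglyMeasurable
  have h4 := integral_im hi
  simp only [Function.comp]
  simp only [RCLike.im_to_complex] at h4
  rw [← h4, ← integral_neg]
  congr 1 with t
  rw [Circle.smul_def, Real.fourierChar_apply, smul_eq_mul, Complex.im_mul_ofReal]
  rw [Complex.exp_ofReal_mul_I_im, show 2 * Real.pi * -(t * (w / (2 * Real.pi))) = -(w * t) by
    field_simp, Real.sin_neg]
  ring

lemma abs_boseKernel_one_sub_inv_le {t : ℝ} (h0 : 0 < t) (h1 : t ≤ 1) :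
    |boseKernel 1 t - 1 / t| ≤ 1 := by
  have hE := exp_sub_one_pos h0
  have h2 := Real.abs_exp_sub_one_sub_id_le (abs_le.2 ⟨by linarith, h1⟩)
  have h3 := Real.add_one_le_exp t
  rw [abs_le] at h2
  unfold boseKernel
  rw [one_mul, div_sub_div _ _ hE.ne' h0.ne', abs_div, abs_of_pos (mul_pos hE h0),
    div_le_one (mul_pos hE h0), abs_le]
  constructor <;> nlinarith

/-- On (0,1] the functions 1/u and 1/(e^u - 1) differ by a bounded function, and the kernel's tail
is integrable. Riemann–Lebesgue removes the difference, and the explicit sine transform of the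
kernel tends to π/2. -/
lemma tendsto_integral_sin_div :
    Tendsto (fun w => ∫ u in Ioc (0 : ℝ) 1, Real.sin (w * u) / u) atTop (𝓝 (Real.pi / 2)) := by
  set d : ℝ → ℝ := (Ioi (0 : ℝ)).indicator
    (fun t => boseKernel 1 t - (Ioc (0 : ℝ) 1).indicator (fun u => 1 / u) t) with hd
  have hint : Integrable d := by
    rw [hd, integrable_indicator_iff measurableSet_Ioi]
    refine Integrable.mono' (g := fun t => (Ioc (0 : ℝ) 1).indicator (fun _ => (1 : ℝ)) t +
      1 / 1 * Real.exp (-(1 / 2) * t)) (Integrable.add ?_ (integrableOn_exp_half one_pos)) ?_ ?_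
    · exact ((integrable_indicator_iff measurableSet_Ioc).2
        (integrableOn_const (by simp))).integrableOn
    · exact ((measurable_boseKernel 1).sub ((by fun_prop : Measurable fun u : ℝ => 1 / u).indicator
        measurableSet_Ioc)).aestronglyMeasurable
    · filter_upwards [ae_restrict_mem measurableSet_Ioi] with t ht
      have ht0 : 0 < t := ht
      by_cases h1 : t ≤ 1
      · have hm : t ∈ Ioc (0 : ℝ) 1 := ⟨ht0, h1⟩
        rw [indicator_of_mem hm, indicator_of_mem hm]
        have := abs_boseKernel_one_sub_inv_le ht0 h1
        rw [Real.norm_eq_abs]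
        have := Real.exp_pos (-(1 / 2) * t)
        linarith
      · rw [indicator_of_notMem (fun h => h1 h.2), indicator_of_notMem (fun h => h1 h.2), sub_zero,
          zero_add, Real.norm_of_nonneg (boseKernel_pos one_pos ht0).le]
        have h3 := self_mul_boseKernel_le one_pos ht0
        have h4 := boseKernel_pos one_pos ht0
        nlinarith
  have hlim : Tendsto (fun w : ℝ => 1 / (2 * 1) * (Real.pi + 2 * Real.pi /
      (Real.exp (2 * Real.pi * (w / 1)) - 1) - 1 / w)) atTop (𝓝 (Real.pi / 2)) := by
    have h := (((tendsto_const_div_exp_sub_one (2 * Real.pi)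
      (c := 2 * Real.pi) (by positivity)).const_add Real.pi).sub
      (tendsto_const_nhds.div_atTop (a := (1 : ℝ)) tendsto_id)).const_mul (1 / (2 * 1))
    simp only [add_zero, sub_zero] at h
    rw [show Real.pi / 2 = 1 / (2 * 1) * Real.pi by ring]
    simpa using h
  have h := hlim.sub (tendsto_integral_mul_sin hint)
  rw [sub_zero] at h
  refine h.congr' ?_
  filter_upwards [eventually_gt_atTop 0] with w hw
  rw [← integral_sin_mul_boseKernel hw.ne' one_pos]
  have e1 : ∫ t, d t * Real.sin (w * t) = ∫ t in Ioi (0 : ℝ), d t * Real.sin (w * t) := by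
    refine (setIntegral_eq_integral_of_forall_compl_eq_zero fun t ht => ?_).symm
    rw [hd, indicator_of_notMem ht, zero_mul]
  have hint2 : Integrable (fun t => d t * Real.sin (w * t)) :=
    hint.mul_bdd (c := 1) (by fun_prop) (ae_of_all _ fun t => Real.abs_sin_le_one _)
  rw [e1, ← integral_sub (integrableOn_sin_mul_boseKernel w one_pos) hint2.integrableOn]
  have e2 : ∀ t ∈ Ioi (0 : ℝ), Real.sin (w * t) * boseKernel 1 t - d t * Real.sin (w * t) =
      (Ioc (0 : ℝ) 1).indicator (fun u => Real.sin (w * u) / u) t := by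
    intro t ht
    rw [hd, indicator_of_mem ht]
    by_cases h1 : t ∈ Ioc (0 : ℝ) 1
    · rw [indicator_of_mem h1, indicator_of_mem h1]; ring
    · rw [indicator_of_notMem h1, indicator_of_notMem h1]; ring
  rw [setIntegral_congr_fun measurableSet_Ioi e2, setIntegral_indicator measurableSet_Ioc,
    inter_eq_self_of_subset_right Ioc_subset_Ioi_self]

/-! ### Removing the singularity at t = 1. -/

/-- A truncation of `1 / (2 (1 - t))` that is odd about `t = 1` on `(0, 2)`. -/
noncomputable def pvKernel (t : ℝ) : ℝ := if t < 2 then 1 / (2 * (1 - t)) else 0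

lemma measurable_pvKernel : Measurable pvKernel :=
  Measurable.ite measurableSet_Iio (by fun_prop) measurable_const

lemma measurableSet_puncturedSet_Ioi (ε : ℝ) : MeasurableSet (puncturedSet (Ioi 0) 1 ε) :=
  measurableSet_Ioi.inter (measurableSet_le measurable_const
    (by fun_prop : Measurable fun t : ℝ => |t - 1|))

lemma integrableOn_pvKernel {ε : ℝ} (hε : 0 < ε) :
    IntegrableOn pvKernel (puncturedSet (Ioi 0) 1 ε) := by
  refine Integrable.mono' (g := (Ioo (0 : ℝ) 2).indicator fun _ => 1 / (2 * ε)) ?_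
    measurable_pvKernel.aestronglyMeasurable ?_
  · exact ((integrable_indicator_iff measurableSet_Ioo).2
      (integrableOn_const (by simp))).integrableOn
  · filter_upwards [ae_restrict_mem (measurableSet_puncturedSet_Ioi ε)] with t ht
    obtain ⟨h0, h1⟩ := ht
    unfold pvKernel
    split_ifs with h
    · have hm : t ∈ Ioo (0 : ℝ) 2 := ⟨h0, h⟩
      rw [indicator_of_mem hm, norm_div, norm_one, norm_mul, Real.norm_ofNat, Real.norm_eq_abs,
        abs_sub_comm]
      gcongr
    · rw [norm_zero]
      exact indicator_nonneg (fun _ _ => by positivity) _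

/-- The reflection t ↦ 2 - t preserves the punctured interval and changes the sign of the integrand.
-/
lemma integral_pvKernel (ε : ℝ) : ∫ t in puncturedSet (Ioi 0) 1 ε, pvKernel t = 0 := by
  rw [← integral_indicator (measurableSet_puncturedSet_Ioi ε)]
  set G := (puncturedSet (Ioi 0) 1 ε).indicator pvKernel with hG
  have h1 : ∀ t, G (2 - t) = -G t := by
    intro t
    simp only [hG, indicator, puncturedSet, mem_ofPred_eq, mem_Ioi, pvKernel]
    have e : |2 - t - 1| = |t - 1| := by rw [← abs_neg]; congr 1; ring
    simp only [e]
    have e2 : 1 / (2 * (1 - (2 - t))) = -(1 / (2 * (1 - t))) := by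
      rw [← div_neg]; congr 1; ring
    by_cases h : ε ≤ |t - 1| <;> by_cases ha : 0 < t <;> by_cases hb : t < 2 <;>
      simp [h, ha, hb, e2]
  have h2 := integral_sub_left_eq_self G volume 2
  simp_rw [h1, integral_neg] at h2
  linarith

/-- The subtracted multiple of `pvKernel` contributes 0 to every truncated integral, so the
principal value is an ordinary integral, by dominated convergence. -/
lemma hasPVIntegral_of_integrable_sub {f : ℝ → ℝ} (K : ℝ)
    (hf : IntegrableOn (fun t => f t - K * pvKernel t) (Ioi 0)) :
    HasPVIntegral f (Ioi 0) 1 (∫ t in Ioi (0 : ℝ), (f t - K * pvKernel t)) := by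
  have hsub : ∀ ε, puncturedSet (Ioi 0) 1 ε ⊆ Ioi 0 := fun ε t ht => ht.1
  have hfe : f = fun t => (f t - K * pvKernel t) + K * pvKernel t := by
    funext t; ring
  refine ⟨fun ε hε => ?_, ?_⟩
  · rw [hfe]
    exact (hf.mono_set (hsub ε)).add ((integrableOn_pvKernel hε).const_mul K)
  · have h1 : ∀ ε > 0, ∫ t in puncturedSet (Ioi 0) 1 ε, f t = ∫ t in Ioi (0 : ℝ),
        (puncturedSet (Ioi 0) 1 ε).indicator (fun t => f t - K * pvKernel t) t := by
      intro ε hε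
      rw [setIntegral_indicator (measurableSet_puncturedSet_Ioi ε),
        inter_eq_self_of_subset_right (hsub ε)]
      have hfi : IntegrableOn f (puncturedSet (Ioi 0) 1 ε) := by
        rw [hfe]
        exact (hf.mono_set (hsub ε)).add ((integrableOn_pvKernel hε).const_mul K)
      rw [integral_sub hfi ((integrableOn_pvKernel hε).const_mul K), integral_const_mul,
        integral_pvKernel]
      simp
    refine Tendsto.congr' (f₁ := fun ε => ∫ t in Ioi (0 : ℝ),
        (puncturedSet (Ioi 0) 1 ε).indicator (fun t => f t - K * pvKernel t) t) ?_ ?_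
    · filter_upwards [self_mem_nhdsWithin] with ε hε
      exact (h1 ε hε).symm
    · refine tendsto_integral_filter_of_dominated_convergence
        (fun t => ‖f t - K * pvKernel t‖) ?_ ?_ hf.norm ?_
      · exact Eventually.of_forall fun ε =>
          hf.aestronglyMeasurable.indicator (measurableSet_puncturedSet_Ioi ε)
      · exact Eventually.of_forall fun ε => ae_of_all _ fun t => norm_indicator_le_norm_self _ _
      · filter_upwards [ae_restrict_mem measurableSet_Ioi,
          (measure_eq_zero_iff_ae_notMem.1 (measure_singleton (1 : ℝ)) :
            ∀ᵐ t ∂(volume.restrict (Ioi (0 : ℝ))), t ∉ ({1} : Set ℝ))] with t ht h1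
        refine tendsto_const_nhds.congr' ?_
        have hpos : 0 < |t - 1| := abs_pos.2 (sub_ne_zero.2 h1)
        filter_upwards [nhdsWithin_le_nhds (eventually_le_nhds hpos)] with ε hε
        rw [indicator_of_mem]
        exact ⟨ht, hε⟩

/-! ### Decomposition and L¹ bound of a single regularised term. -/

lemma hasDerivAt_sq_mul_boseKernel {c t : ℝ} (hc : 0 < c) (ht : 0 < t) :
    HasDerivAt (fun t => t ^ 2 * boseKernel c t)
      (2 * (t * boseKernel c t) - c * (t ^ 2 * Real.exp (c * t) * boseKernel c t ^ 2)) t := by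
  have hE := exp_sub_one_pos (mul_pos hc ht)
  have e1 : HasDerivAt (fun s => Real.exp (c * s) - 1) (Real.exp (c * t) * c) t := by
    simpa using (((hasDerivAt_id t).const_mul c).exp).sub_const 1
  have e2 := (hasDerivAt_pow 2 t).mul (e1.inv hE.ne')
  unfold boseKernel
  simp only [one_div]
  refine e2.congr_deriv ?_
  simp only [Nat.cast_ofNat, Nat.add_one_sub_one, pow_one, Pi.inv_apply]
  field_simp
  ring

lemma boseKernel_one_le {c : ℝ} (hc : 0 < c) : boseKernel c 1 ≤ 1 / c := by
  have h := self_mul_boseKernel_le hc one_pos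
  have h2 : Real.exp (-(c / 2) * 1) ≤ 1 := Real.exp_le_one_iff.2 (by linarith)
  calc boseKernel c 1 ≤ 1 / c * Real.exp (-(c / 2) * 1) := by simpa using h
    _ ≤ 1 / c * 1 := by gcongr
    _ = 1 / c := mul_one _

/-- The second power of 1/c is needed against the factor |b| in the bound for `pvSin`, since b and c
both grow like n. -/
lemma boseKernel_one_le_sq {c : ℝ} (hc : 0 < c) : boseKernel c 1 ≤ 2 / c ^ 2 := by
  have h := self_mul_boseKernel_le hc one_pos
  have h2 : Real.exp (-(c / 2) * 1) ≤ 2 / c := by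
    rw [mul_one, Real.exp_neg, inv_le_comm₀ (Real.exp_pos _) (by positivity), inv_div]
    linarith [Real.add_one_le_exp (c / 2)]
  calc boseKernel c 1 ≤ 1 / c * Real.exp (-(c / 2) * 1) := by simpa using h
    _ ≤ 1 / c * (2 / c) := by gcongr
    _ = 2 / c ^ 2 := by field_simp

/-- Mean value inequality: the derivative has the form 2A - B with A and B both in [0, 1/c]. -/
lemma abs_sq_mul_boseKernel_sub_le {c t : ℝ} (hc : 0 < c) (ht : 0 < t) :
    |t ^ 2 * boseKernel c t - boseKernel c 1| ≤ 2 / c * |t - 1| := by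
  have h := (convex_Ioi (0 : ℝ)).norm_image_sub_le_of_norm_hasDerivWithin_le
    (f := fun t => t ^ 2 * boseKernel c t) (C := 2 / c)
    (fun x hx => (hasDerivAt_sq_mul_boseKernel hc hx).hasDerivWithinAt) (fun x hx => ?_)
    (mem_Ioi.2 one_pos) (mem_Ioi.2 ht)
  · simpa using h
  have hx : 0 < x := hx
  have hH := boseKernel_pos hc hx
  have h1 : x * boseKernel c x ≤ 1 / c := by
    refine (self_mul_boseKernel_le hc hx).trans ?_
    have h2 : Real.exp (-(c / 2) * x) ≤ 1 := Real.exp_le_one_iff.2 (by nlinarith)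
    calc 1 / c * Real.exp (-(c / 2) * x) ≤ 1 / c * 1 := by gcongr
      _ = 1 / c := mul_one _
  have h3 : c * (x ^ 2 * Real.exp (c * x) * boseKernel c x ^ 2) ≤ 1 / c := by
    have hE := exp_sub_one_pos (mul_pos hc hx)
    have h4 := self_mul_exp_half_le (mul_pos hc hx).le
    have h5 : (c * x) ^ 2 * Real.exp (c * x) ≤ (Real.exp (c * x) - 1) ^ 2 := by
      calc (c * x) ^ 2 * Real.exp (c * x) = (c * x * Real.exp (c * x / 2)) ^ 2 := by
            rw [mul_pow (c * x) (Real.exp _), ← Real.exp_nat_mul]; congr 2; push_cast; ring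
        _ ≤ _ := by gcongr
    unfold boseKernel
    rw [div_pow, one_pow, mul_one_div, mul_div_assoc', div_le_div_iff₀ (by positivity) hc]
    nlinarith
  have h6 : 0 ≤ c * (x ^ 2 * Real.exp (c * x) * boseKernel c x ^ 2) := by positivity
  have h7 : 0 < x * boseKernel c x := by positivity
  have h8 : 2 / c = 2 * (1 / c) := by ring
  rw [Real.norm_eq_abs, abs_le, h8]
  constructor <;> linarith

/-- The part of the Bose kernel over `1 - t ^ 2` that is regular at `0` and `1`. -/
noncomputable def boseRem (c t : ℝ) : ℝ :=
  t ^ 2 * boseKernel c t / (1 - t ^ 2) - boseKernel c 1 * pvKernel t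

lemma measurable_boseRem (c : ℝ) : Measurable (boseRem c) :=
  (((by fun_prop : Measurable fun t : ℝ => t ^ 2).mul (measurable_boseKernel c)).div
    (by fun_prop)).sub (measurable_pvKernel.const_mul _)

lemma abs_boseRem_le_of_lt {c t : ℝ} (hc : 0 < c) (ht : 0 < t) (h2 : t < 2) :
    |boseRem c t| ≤ 3 / c := by
  unfold boseRem pvKernel
  rw [if_pos h2]
  rcases eq_or_ne t 1 with rfl | h1
  -- At t = 1 both quotients have denominator 0 and are 0 by convention.
  · simp; positivity
  have h1' : 1 - t ≠ 0 := sub_ne_zero.2 h1.symm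
  have h1t : 0 < 1 + t := by linarith
  -- A difference quotient at 1, plus the remainder 1/(1-t²) - 1/(2(1-t)) = 1/(2(1+t)).
  have e : t ^ 2 * boseKernel c t / (1 - t ^ 2) - boseKernel c 1 * (1 / (2 * (1 - t))) =
      ((t ^ 2 * boseKernel c t - boseKernel c 1) / (1 - t)) / (1 + t) +
        boseKernel c 1 / (2 * (1 + t)) := by
    rw [show 1 - t ^ 2 = (1 - t) * (1 + t) by ring]
    field_simp
    ring
  rw [e]
  have b1 : |(t ^ 2 * boseKernel c t - boseKernel c 1) / (1 - t)| ≤ 2 / c := by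
    rw [abs_div, div_le_iff₀ (abs_pos.2 h1'), abs_sub_comm 1 t]
    exact abs_sq_mul_boseKernel_sub_le hc ht
  have b2 := boseKernel_one_le hc
  have b3 := boseKernel_pos hc one_pos
  calc _ ≤ |((t ^ 2 * boseKernel c t - boseKernel c 1) / (1 - t)) / (1 + t)| +
        |boseKernel c 1 / (2 * (1 + t))| := abs_add_le _ _
    _ ≤ 2 / c + 1 / c := by
        refine add_le_add ?_ ?_
        · rw [abs_div, abs_of_pos h1t]
          exact (div_le_self (abs_nonneg _) (by linarith)).trans b1
        · rw [abs_of_pos (by positivity)]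
          exact (div_le_self b3.le (by linarith)).trans b2
    _ = 3 / c := by ring

lemma abs_boseRem_le_of_ge {c t : ℝ} (hc : 0 < c) (h2 : 2 ≤ t) :
    |boseRem c t| ≤ 1 / c * Real.exp (-(c / 2) * t) := by
  have ht : 0 < t := by linarith
  unfold boseRem pvKernel
  have hH := boseKernel_pos hc ht
  rw [if_neg (not_lt.2 h2), mul_zero, sub_zero, abs_div, abs_of_pos (by positivity),
    abs_of_neg (by nlinarith), div_le_iff₀ (by nlinarith)]
  have h := self_mul_boseKernel_le hc ht
  have hpos : 0 ≤ 1 / c * Real.exp (-(c / 2) * t) := by positivity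
  calc t ^ 2 * boseKernel c t = t * (t * boseKernel c t) := by ring
    _ ≤ t * (1 / c * Real.exp (-(c / 2) * t)) := by gcongr
    _ ≤ (-(1 - t ^ 2)) * (1 / c * Real.exp (-(c / 2) * t)) := by
        refine mul_le_mul_of_nonneg_right ?_ hpos
        nlinarith
    _ = _ := by ring

lemma abs_boseRem_le {c t : ℝ} (hc : 0 < c) (ht : 0 < t) :
    |boseRem c t| ≤ (Ioo (0 : ℝ) 2).indicator (fun _ => 3 / c) t +
      1 / c * Real.exp (-(c / 2) * t) := by
  rcases lt_or_ge t 2 with h | h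
  · rw [indicator_of_mem (show t ∈ Ioo (0 : ℝ) 2 from ⟨ht, h⟩)]
    have := abs_boseRem_le_of_lt hc ht h
    have : 0 < 1 / c * Real.exp (-(c / 2) * t) := by positivity
    linarith
  · rw [indicator_of_notMem (fun h' => not_lt.2 h h'.2), zero_add]
    exact abs_boseRem_le_of_ge hc h

lemma integrableOn_indicator_Ioo (K : ℝ) (s : Set ℝ) :
    IntegrableOn ((Ioo (0 : ℝ) 2).indicator fun _ => K) s :=
  ((integrable_indicator_iff measurableSet_Ioo).2 (integrableOn_const (by simp))).integrableOn

lemma integrableOn_boseRem {c : ℝ} (hc : 0 < c) : IntegrableOn (boseRem c) (Ioi 0) := by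
  refine Integrable.mono' ((integrableOn_indicator_Ioo (3 / c) _).add (integrableOn_exp_half hc))
    (measurable_boseRem c).aestronglyMeasurable ?_
  filter_upwards [ae_restrict_mem measurableSet_Ioi] with t ht
  exact abs_boseRem_le hc ht

/-- The odd part at `t = 1` of the sine over the truncated kernel. -/
noncomputable def pvSin (b t : ℝ) : ℝ := pvKernel t * (Real.sin (b * t) - Real.sin b)

lemma measurable_pvSin (b : ℝ) : Measurable (pvSin b) :=
  measurable_pvKernel.mul (by fun_prop)

lemma abs_sin_sub_sin_le (x y : ℝ) : |Real.sin x - Real.sin y| ≤ |x - y| := by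
  rw [Real.sin_sub_sin, abs_mul, abs_mul, abs_two]
  have h1 : |Real.sin ((x - y) / 2)| ≤ |(x - y) / 2| := Real.abs_sin_le_abs
  have h2 := Real.abs_cos_le_one ((x + y) / 2)
  rw [abs_div, abs_two] at h1
  nlinarith [abs_nonneg (Real.sin ((x - y) / 2))]

lemma abs_pvSin_le {t : ℝ} (b : ℝ) (ht : 0 < t) :
    |pvSin b t| ≤ (Ioo (0 : ℝ) 2).indicator (fun _ => |b| / 2) t := by
  unfold pvSin pvKernel
  split_ifs with h
  · rw [indicator_of_mem (show t ∈ Ioo (0 : ℝ) 2 from ⟨ht, h⟩)]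
    rcases eq_or_ne t 1 with rfl | h1
    · simp; positivity
    have h1' : 0 < |1 - t| := abs_pos.2 (sub_ne_zero.2 h1.symm)
    have h3 : |b * t - b| = |b| * |1 - t| := by
      rw [← abs_mul, ← abs_neg]; congr 1; ring
    rw [abs_mul, abs_div, abs_one, abs_mul, abs_two]
    have h4 := abs_sin_sub_sin_le (b * t) b
    rw [h3] at h4
    rw [one_div, inv_mul_le_iff₀ (by positivity)]
    linarith
  · simp only [zero_mul, abs_zero]
    exact indicator_nonneg (fun _ _ => by positivity) _

lemma integrableOn_pvSin (b : ℝ) : IntegrableOn (pvSin b) (Ioi 0) := by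
  refine Integrable.mono' (integrableOn_indicator_Ioo (|b| / 2) _)
    (measurable_pvSin b).aestronglyMeasurable ?_
  filter_upwards [ae_restrict_mem measurableSet_Ioi] with t ht
  exact abs_pvSin_le b ht

/-- Pairing t = 1 - u with t = 1 + u leaves (sin(b-bu) - sin(b+bu))/(2u) = -cos b · sin(bu)/u. -/
lemma integral_pvSin (b : ℝ) :
    ∫ t in Ioi (0 : ℝ), pvSin b t = -Real.cos b * ∫ u in Ioc (0 : ℝ) 1, Real.sin (b * u) / u := by
  have h0 : ∫ t in Ioi (0 : ℝ), pvSin b t = ∫ t in Ioc (0 : ℝ) 2, pvSin b t := by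
    refine setIntegral_eq_of_subset_of_forall_sdiff_eq_zero measurableSet_Ioi Ioc_subset_Ioi_self ?_
    intro t ht
    unfold pvSin pvKernel
    rw [if_neg, zero_mul]
    intro h
    exact ht.2 ⟨ht.1, h.le⟩
  have hi : ∀ x y : ℝ, 0 ≤ x → x ≤ y → IntervalIntegrable (pvSin b) volume x y := by
    intro x y hx hxy
    rw [intervalIntegrable_iff_integrableOn_Ioc_of_le hxy]
    exact (integrableOn_pvSin b).mono_set fun t ht => lt_of_le_of_lt hx ht.1
  have h1 : ∫ t in (0 : ℝ)..1, pvSin b t = ∫ u in (0 : ℝ)..1, pvSin b (1 - u) := by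
    rw [intervalIntegral.integral_comp_sub_left]; norm_num
  have h2 : ∫ t in (1 : ℝ)..2, pvSin b t = ∫ u in (0 : ℝ)..1, pvSin b (1 + u) := by
    rw [intervalIntegral.integral_comp_add_left]; norm_num
  have i1 : IntervalIntegrable (fun u => pvSin b (1 - u)) volume 0 1 := by
    have := (hi 0 1 le_rfl zero_le_one).comp_sub_left 1
    simpa using this.symm
  have i2 : IntervalIntegrable (fun u => pvSin b (1 + u)) volume 0 1 := by
    have := (hi 1 2 zero_le_one (by norm_num)).comp_add_left 1
    norm_num at this
    exact this
  rw [h0, ← intervalIntegral.integral_of_le (by norm_num),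
    ← intervalIntegral.integral_add_adjacent_intervals (hi 0 1 le_rfl zero_le_one)
      (hi 1 2 zero_le_one (by norm_num)), h1, h2, ← intervalIntegral.integral_add i1 i2,
    ← intervalIntegral.integral_of_le zero_le_one, ← intervalIntegral.integral_const_mul]
  refine intervalIntegral.integral_congr_ae ?_
  filter_upwards [measure_eq_zero_iff_ae_notMem.1 (measure_singleton (1 : ℝ))] with u hu1 hu
  rw [uIoc_of_le zero_le_one] at hu
  have hu0 := hu.1
  have hlt : u < 1 := lt_of_le_of_ne hu.2 hu1
  unfold pvSin pvKernel
  rw [if_pos (by linarith), if_pos (by linarith), show b * (1 - u) = b - b * u by ring,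
    show b * (1 + u) = b + b * u by ring, Real.sin_sub, Real.sin_add]
  have hu0' := hu0.ne'
  field_simp
  ring_nf
  field_simp

/-- `sin (b t) / ((e^{ct} - 1) (1 - t ^ 2))` with its singularity at `t = 1` removed. -/
noncomputable def pvTerm (b c t : ℝ) : ℝ :=
  Real.sin (b * t) * boseKernel c t * (1 / (1 - t ^ 2)) -
    Real.sin b * boseKernel c 1 * pvKernel t

/-- Uses 1/(1-t²) = 1 + t²/(1-t²), where t² absorbs the kernel's pole at 0. As b → ∞ the three
pieces fall to the explicit sine transform, Riemann–Lebesgue and the Dirichlet integral. -/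
lemma pvTerm_eq {b c t : ℝ} (ht : 0 < t) (h1 : t ≠ 1) :
    pvTerm b c t = Real.sin (b * t) * boseKernel c t + boseRem c t * Real.sin (b * t) +
      boseKernel c 1 * pvSin b t := by
  have h : 1 - t ^ 2 ≠ 0 := by
    rw [show 1 - t ^ 2 = (1 - t) * (1 + t) by ring]
    exact mul_ne_zero (sub_ne_zero.2 h1.symm) (by linarith)
  unfold pvTerm boseRem pvSin
  field_simp
  ring

lemma pvTerm_ae_eq (b c : ℝ) : pvTerm b c =ᵐ[volume.restrict (Ioi 0)] fun t =>
    Real.sin (b * t) * boseKernel c t + boseRem c t * Real.sin (b * t) +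
      boseKernel c 1 * pvSin b t := by
  filter_upwards [ae_restrict_mem measurableSet_Ioi,
    (measure_eq_zero_iff_ae_notMem.1 (measure_singleton (1 : ℝ)) :
      ∀ᵐ t ∂(volume.restrict (Ioi (0 : ℝ))), t ∉ ({1} : Set ℝ))] with t ht h1
  exact pvTerm_eq ht h1

lemma integrableOn_boseRem_mul_sin {c : ℝ} (b : ℝ) (hc : 0 < c) :
    IntegrableOn (fun t => boseRem c t * Real.sin (b * t)) (Ioi 0) :=
  (integrableOn_boseRem hc).mul_bdd (c := 1) (by fun_prop)
    (ae_of_all _ fun t => Real.abs_sin_le_one _)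

lemma integrableOn_pvTerm {c : ℝ} (b : ℝ) (hc : 0 < c) : IntegrableOn (pvTerm b c) (Ioi 0) :=
  (((integrableOn_sin_mul_boseKernel b hc).add (integrableOn_boseRem_mul_sin b hc)).add
    ((integrableOn_pvSin b).const_mul _)).congr (pvTerm_ae_eq b c).symm

lemma integral_pvTerm {c : ℝ} (b : ℝ) (hc : 0 < c) :
    ∫ t in Ioi (0 : ℝ), pvTerm b c t = (∫ t in Ioi (0 : ℝ), Real.sin (b * t) * boseKernel c t) +
      (∫ t in Ioi (0 : ℝ), boseRem c t * Real.sin (b * t)) +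
      boseKernel c 1 * ∫ t in Ioi (0 : ℝ), pvSin b t := by
  rw [integral_congr_ae (pvTerm_ae_eq b c), integral_add _ ((integrableOn_pvSin b).const_mul _),
    integral_add (integrableOn_sin_mul_boseKernel b hc) (integrableOn_boseRem_mul_sin b hc),
    integral_const_mul]
  exact (integrableOn_sin_mul_boseKernel b hc).add (integrableOn_boseRem_mul_sin b hc)

lemma integral_norm_pvTerm_le {c : ℝ} (b : ℝ) (hc : 0 < c) :
    ∫ t in Ioi (0 : ℝ), ‖pvTerm b c t‖ ≤ (4 * |b| / c + 6) / c + 2 / c ^ 2 := by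
  have hI := integrableOn_exp_half hc
  have hle : ∫ t in Ioi (0 : ℝ), ‖pvTerm b c t‖ ≤ ∫ t in Ioi (0 : ℝ),
      ((|b| + 1) * (1 / c * Real.exp (-(c / 2) * t)) +
        (Ioo (0 : ℝ) 2).indicator (fun _ => 3 / c + |b| / c ^ 2) t) := by
    refine integral_mono_ae (integrableOn_pvTerm b hc).norm
      ((hI.const_mul _).add (integrableOn_indicator_Ioo _ _)) ?_
    filter_upwards [ae_restrict_mem measurableSet_Ioi, pvTerm_ae_eq b c] with t ht he
    rw [he]
    have hH := boseKernel_pos hc one_pos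
    have b1 := abs_sin_mul_boseKernel_le b hc ht
    have b2 : |boseRem c t * Real.sin (b * t)| ≤ (Ioo (0 : ℝ) 2).indicator (fun _ => 3 / c) t +
        1 / c * Real.exp (-(c / 2) * t) := by
      rw [abs_mul]
      exact (mul_le_of_le_one_right (abs_nonneg _) (Real.abs_sin_le_one _)).trans
        (abs_boseRem_le hc ht)
    have b3 : |boseKernel c 1 * pvSin b t| ≤ 2 / c ^ 2 *
        (Ioo (0 : ℝ) 2).indicator (fun _ => |b| / 2) t := by
      rw [abs_mul, abs_of_pos hH]
      exact mul_le_mul (boseKernel_one_le_sq hc) (abs_pvSin_le b ht) (abs_nonneg _) (by positivity)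
    have e : (Ioo (0 : ℝ) 2).indicator (fun _ => 3 / c + |b| / c ^ 2) t =
        (Ioo (0 : ℝ) 2).indicator (fun _ => 3 / c) t +
        2 / c ^ 2 * (Ioo (0 : ℝ) 2).indicator (fun _ => |b| / 2) t := by
      by_cases h : t ∈ Ioo (0 : ℝ) 2
      · rw [indicator_of_mem h, indicator_of_mem h, indicator_of_mem h]; field_simp
      · rw [indicator_of_notMem h, indicator_of_notMem h, indicator_of_notMem h]; simp
    rw [e, Real.norm_eq_abs]
    refine (abs_add_le _ _).trans ?_
    have := abs_add_le (Real.sin (b * t) * boseKernel c t) (boseRem c t * Real.sin (b * t))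
    linarith
  refine hle.trans (le_of_eq ?_)
  rw [integral_add (hI.const_mul _) (integrableOn_indicator_Ioo _ _), integral_const_mul,
    integral_const_mul, integral_exp_mul_Ioi (by linarith),
    setIntegral_indicator measurableSet_Ioo, inter_eq_self_of_subset_right Ioo_subset_Ioi_self,
    setIntegral_const]
  simp
  field_simp
  ring

/-! ### Summing the principal values term by term. -/

lemma integrable_of_hasSum_of_summable_integral_norm {X : Type*} [MeasurableSpace X]
    {μ : Measure X} {F : ℕ → X → ℝ} {f : X → ℝ} (hF : ∀ i, Integrable (F i) μ)
    (hs : Summable fun i => ∫ a, ‖F i a‖ ∂μ) (hf : ∀ᵐ a ∂μ, HasSum (fun i => F i a) (f a)) :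
    Integrable f μ := by
  have hm : AEStronglyMeasurable f μ := by
    refine aestronglyMeasurable_of_tendsto_ae (f := fun (N : ℕ) a => ∑ i ∈ Finset.range N, F i a)
      atTop (fun N => ?_) ?_
    · exact Finset.aestronglyMeasurable_fun_sum _ fun i _ => (hF i).1
    · filter_upwards [hf] with a ha
      exact ha.tendsto_sum_nat
  refine ⟨hm, ?_⟩
  have h1 : ∑' i, ∫⁻ a, ‖F i a‖ₑ ∂μ ≠ ⊤ := by
    have (i : ℕ) : ∫⁻ a, ‖F i a‖ₑ ∂μ = ENNReal.ofReal (∫ a, ‖F i a‖ ∂μ) := by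
      rw [ofReal_integral_norm_eq_lintegral_enorm (hF i)]
    simp_rw [this]
    rw [← ENNReal.ofReal_tsum_of_nonneg (fun i => integral_nonneg fun _ => norm_nonneg _) hs]
    exact ENNReal.ofReal_ne_top
  rw [← lintegral_tsum fun i => (hF i).1.enorm] at h1
  refine lt_of_le_of_lt (lintegral_mono_ae ?_) h1.lt_top
  filter_upwards [hf] with a ha
  rw [← ha.tsum_eq]
  exact enorm_tsum_le_tsum_enorm

/-- The angular frequency `2π(n+1)`. -/
noncomputable def freq (n : ℕ) : ℝ := 2 * Real.pi * (n + 1)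

lemma freq_pos (n : ℕ) : 0 < freq n := by unfold freq; positivity

lemma sinTerm_eq (α ν t : ℝ) (n : ℕ) :
    sinTerm α ν t n = 1 / (n + 1) *
      (Real.sin (freq n * ν * t) * boseKernel (freq n / α) t) := by
  unfold sinTerm boseKernel freq
  rw [show 2 * ((n : ℝ) + 1) * ν * Real.pi * t = 2 * Real.pi * (n + 1) * ν * t by ring,
    show 2 * ((n : ℝ) + 1) * Real.pi * t / α = 2 * Real.pi * (n + 1) / α * t by ring]
  rw [mul_one_div, div_mul_div_comm, one_mul]

lemma cosTerm_eq (α ν : ℝ) (n : ℕ) :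
    cosTerm α ν n = 1 / (n + 1) * (Real.cos (freq n * ν) * boseKernel (freq n / α) 1) := by
  unfold cosTerm boseKernel freq
  rw [show 2 * ((n : ℝ) + 1) * Real.pi * ν = 2 * Real.pi * (n + 1) * ν by ring,
    show 2 * ((n : ℝ) + 1) * Real.pi / α = 2 * Real.pi * (n + 1) / α * 1 by ring]
  rw [mul_one_div, div_mul_div_comm, one_mul]

lemma boseKernel_le_inv {c t : ℝ} (hc : 0 < c) (ht : 0 < t) : boseKernel c t ≤ 1 / (c * t) := by
  have h := boseKernel_one_le (mul_pos hc ht)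
  unfold boseKernel at *
  rwa [mul_one] at h

lemma one_div_mul_boseKernel_le {α t : ℝ} (hα : 0 < α) (ht : 0 < t) (n : ℕ) :
    1 / ((n : ℝ) + 1) * boseKernel (freq n / α) t ≤
      α / (2 * Real.pi * t) * (1 / (1 * ((n : ℝ) + 1)) ^ 2) := by
  have h := boseKernel_le_inv (div_pos (freq_pos n) hα) ht
  calc _ ≤ 1 / ((n : ℝ) + 1) * (1 / (freq n / α * t)) := by gcongr
    _ = _ := by unfold freq; field_simp

lemma summable_of_abs_le_boseKernel {α t : ℝ} (hα : 0 < α) (ht : 0 < t) {s : ℕ → ℝ}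
    (hs : ∀ n, |s n| ≤ 1) :
    Summable fun n : ℕ => 1 / ((n : ℝ) + 1) * (s n * boseKernel (freq n / α) t) := by
  refine Summable.of_norm_bounded ((summable_one_div_mul_succ_sq 1).mul_left
    (α / (2 * Real.pi * t))) fun n => ?_
  have hH := boseKernel_pos (div_pos (freq_pos n) hα) ht
  refine le_trans ?_ (one_div_mul_boseKernel_le hα ht n)
  rw [Real.norm_eq_abs, abs_mul, abs_mul, abs_of_pos hH, abs_of_pos (by positivity)]
  gcongr
  exact mul_le_of_le_one_left hH.le (hs n)

lemma summable_sinTerm {α t : ℝ} (ν : ℝ) (hα : 0 < α) (ht : 0 < t) : Summable (sinTerm α ν t) := by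
  refine (summable_of_abs_le_boseKernel hα ht
    (s := fun n => Real.sin (freq n * ν * t)) fun n => Real.abs_sin_le_one _).congr fun n => ?_
  rw [sinTerm_eq]

lemma summable_cosTerm {α : ℝ} (ν : ℝ) (hα : 0 < α) : Summable (cosTerm α ν) := by
  refine (summable_of_abs_le_boseKernel hα one_pos
    (s := fun n => Real.cos (freq n * ν)) fun n => Real.abs_cos_le_one _).congr fun n => ?_
  rw [cosTerm_eq]

/-- The regularised principal value integral of the summand of index `n + 1`. -/
noncomputable def pvCoeff (α ν : ℝ) (n : ℕ) : ℝ :=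
  ∫ t in Ioi (0 : ℝ), pvTerm (freq n * ν) (freq n / α) t

lemma hasSum_pvTerm {α ν t : ℝ} (hα : 0 < α) (ht : 0 < t) :
    HasSum (fun n : ℕ => 1 / ((n : ℝ) + 1) * pvTerm (freq n * ν) (freq n / α) t)
      (singIntegrand α ν t - (∑' n, sinTerm α ν 1 n) * pvKernel t) := by
  have h1 := ((summable_sinTerm ν hα ht).hasSum.mul_right (1 / (1 - t ^ 2))).sub
    ((summable_sinTerm ν hα one_pos).hasSum.mul_right (pvKernel t))
  refine h1.congr_fun fun n => ?_
  rw [sinTerm_eq, sinTerm_eq]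
  unfold pvTerm
  rw [mul_one]
  ring

/-- With b = `freq n` · ν and c = `freq n` / α the ratio |b|/c = α|ν| does not depend on n, so each
L¹ norm is O(1/n) and the weight 1/(n+1) makes the series converge. -/
lemma summable_integral_norm_pvTerm {α : ℝ} (ν : ℝ) (hα : 0 < α) :
    Summable fun n : ℕ => ∫ t in Ioi (0 : ℝ),
      ‖1 / ((n : ℝ) + 1) * pvTerm (freq n * ν) (freq n / α) t‖ := by
  refine Summable.of_nonneg_of_le (fun n => integral_nonneg fun _ => norm_nonneg _) (fun n => ?_)
    ((summable_one_div_mul_succ_sq 1).mul_left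
      ((4 * α * |ν| + 6) * α / (2 * Real.pi) + 2 * α ^ 2 / (2 * Real.pi) ^ 2))
  have hω := freq_pos n
  have h := integral_norm_pvTerm_le (freq n * ν) (div_pos hω hα)
  simp_rw [norm_mul]
  rw [integral_const_mul, Real.norm_of_nonneg (by positivity)]
  have hn : (1 : ℝ) ≤ n + 1 := by linarith [Nat.cast_nonneg (α := ℝ) n]
  have e : 4 * |freq n * ν| / (freq n / α) = 4 * α * |ν| := by
    rw [abs_mul, abs_of_pos hω]; field_simp
  rw [e] at h
  calc _ ≤ 1 / ((n : ℝ) + 1) * ((4 * α * |ν| + 6) / (freq n / α) + 2 / (freq n / α) ^ 2) := by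
        gcongr
    _ = (4 * α * |ν| + 6) * α / (2 * Real.pi) * (1 / ((n : ℝ) + 1) ^ 2) +
        2 * α ^ 2 / (2 * Real.pi) ^ 2 * (1 / (((n : ℝ) + 1) ^ 2 * (n + 1))) := by
        unfold freq; field_simp
    _ ≤ (4 * α * |ν| + 6) * α / (2 * Real.pi) * (1 / ((n : ℝ) + 1) ^ 2) +
        2 * α ^ 2 / (2 * Real.pi) ^ 2 * (1 / ((n : ℝ) + 1) ^ 2) := by
        gcongr
        exact le_mul_of_one_le_right (by positivity) hn
    _ = _ := by rw [one_mul]; ring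

lemma hasSum_pvCoeff {α : ℝ} (ν : ℝ) (hα : 0 < α) :
    ∃ v, HasSum (fun n : ℕ => 1 / ((n : ℝ) + 1) * pvCoeff α ν n) v ∧
      HasPVIntegral (singIntegrand α ν) (Ioi 0) 1 v := by
  have hF : ∀ n : ℕ, IntegrableOn
      (fun t => 1 / ((n : ℝ) + 1) * pvTerm (freq n * ν) (freq n / α) t) (Ioi 0) :=
    fun n => (integrableOn_pvTerm _ (div_pos (freq_pos n) hα)).const_mul _
  have hs := summable_integral_norm_pvTerm ν hα
  have hae : ∀ᵐ t ∂(volume.restrict (Ioi (0 : ℝ))),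
      HasSum (fun n : ℕ => 1 / ((n : ℝ) + 1) * pvTerm (freq n * ν) (freq n / α) t)
      (singIntegrand α ν t - (∑' n, sinTerm α ν 1 n) * pvKernel t) := by
    filter_upwards [ae_restrict_mem measurableSet_Ioi] with t ht
    exact hasSum_pvTerm hα ht
  have hint := integrable_of_hasSum_of_summable_integral_norm hF hs hae
  refine ⟨_, ?_, hasPVIntegral_of_integrable_sub _ hint⟩
  have h := hasSum_integral_of_summable_integral_norm hF hs
  rw [integral_congr_ae (hae.mono fun t ht => ht.tsum_eq)] at h
  refine h.congr_fun fun n => ?_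
  rw [integral_const_mul]
  rfl

/-! ### From principal values to Euler–Maclaurin remainders. -/

/-- Source of the factor 1/(1-t²): an explicit antiderivative, whose endpoint values simplify
because ωk is a multiple of 2π. -/
lemma integral_cos_mul_cos {ω t ν : ℝ} (hω : 0 < ω) (ht : 0 < t) (h1 : t ≠ 1) (k : ℕ)
    (hc : Real.cos (ω * k) = 1) (hs : Real.sin (ω * k) = 0) :
    ∫ s in ν..(ν + k), Real.cos (ω * s * t) * Real.cos (ω * (s - ν)) =
      t * (Real.sin (ω * ν * t) - Real.sin (ω * (ν + k) * t)) / (ω * (1 - t ^ 2)) := by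
  have h : 1 - t ^ 2 ≠ 0 := by
    rw [show 1 - t ^ 2 = (1 - t) * (1 + t) by ring]
    exact mul_ne_zero (sub_ne_zero.2 h1.symm) (by linarith)
  have hder : ∀ s ∈ uIcc ν (ν + k), HasDerivAt
      (fun s => (-t * (Real.sin (ω * s * t) * Real.cos (ω * (s - ν))) +
        Real.cos (ω * s * t) * Real.sin (ω * (s - ν))) / (ω * (1 - t ^ 2)))
      (Real.cos (ω * s * t) * Real.cos (ω * (s - ν))) s := by
    intro s _
    have e1 : HasDerivAt (fun s => ω * s * t) (ω * t) s := by
      simpa using ((hasDerivAt_id s).const_mul ω).mul_const t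
    have e2 : HasDerivAt (fun s => ω * (s - ν)) ω s := by
      simpa using ((hasDerivAt_id s).sub_const ν).const_mul ω
    have := ((((e1.sin).mul e2.cos).const_mul (-t)).add ((e1.cos).mul e2.sin)).div_const
      (ω * (1 - t ^ 2))
    refine this.congr_deriv ?_
    rw [div_eq_iff (mul_ne_zero hω.ne' h)]
    ring
  rw [intervalIntegral.integral_eq_sub_of_hasDerivAt hder
    (Continuous.intervalIntegrable (by fun_prop) _ _)]
  rw [add_sub_cancel_left, hc, hs, sub_self, mul_zero, mul_zero, Real.cos_zero, Real.sin_zero]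
  ring

lemma cos_freq_mul_nat (n k : ℕ) : Real.cos (freq n * k) = 1 := by
  unfold freq
  rw [show 2 * Real.pi * ((n : ℝ) + 1) * k = (((n + 1) * k : ℕ) : ℝ) * (2 * Real.pi) by
    push_cast; ring]
  exact Real.cos_nat_mul_two_pi _

lemma sin_freq_mul_nat (n k : ℕ) : Real.sin (freq n * k) = 0 := by
  unfold freq
  rw [show 2 * Real.pi * ((n : ℝ) + 1) * k = ((2 * (n + 1) * k : ℕ) : ℝ) * Real.pi by
    push_cast; ring]
  exact Real.sin_nat_mul_pi _

lemma cos_freq_mul_add_nat (n k : ℕ) (ν : ℝ) :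
    Real.cos (freq n * (ν + k)) = Real.cos (freq n * ν) := by
  rw [mul_add, Real.cos_add, cos_freq_mul_nat, sin_freq_mul_nat, mul_one, mul_zero, sub_zero]

lemma sin_freq_mul_add_nat (n k : ℕ) (ν : ℝ) :
    Real.sin (freq n * (ν + k)) = Real.sin (freq n * ν) := by
  rw [mul_add, Real.sin_add, cos_freq_mul_nat, sin_freq_mul_nat, mul_one, mul_zero, add_zero]

lemma integral_bosePsiDeriv_mul_cos {α : ℝ} (hα : 0 < α) (ν : ℝ) (n k : ℕ) :
    ∫ s in ν..(ν + k), bosePsiDeriv α s * Real.cos (freq n * (s - ν)) =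
      2 * freq n * (pvCoeff α ν n - pvCoeff α (ν + k) n) + bosePsi α (ν + k) - bosePsi α ν := by
  have hω := freq_pos n
  set ω := freq n with hωd
  have hc : 0 < ω / α := div_pos hω hα
  have hswap : ∫ s in ν..(ν + k), ∫ t in Ioi (0 : ℝ),
      Real.cos (ω * s * t) * (t * boseKernel (ω / α) t) * Real.cos (ω * (s - ν)) =
      ∫ t in Ioi (0 : ℝ), ∫ s in ν..(ν + k),
      Real.cos (ω * s * t) * (t * boseKernel (ω / α) t) * Real.cos (ω * (s - ν)) := by
    refine intervalIntegral_integral_swap ?_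
    have hb : Integrable (fun z : ℝ × ℝ => (1 : ℝ) * (z.2 * boseKernel (ω / α) z.2))
        ((volume.restrict (uIoc ν (ν + k))).prod (volume.restrict (Ioi 0))) :=
      Integrable.mul_prod (f := fun _ : ℝ => (1 : ℝ)) (integrableOn_const (by simp [uIoc]))
        (integrableOn_self_mul_boseKernel hc)
    refine hb.mono' ?_ ?_
    · refine Measurable.aestronglyMeasurable ?_
      have := (measurable_id_mul_boseKernel (ω / α)).comp
        (measurable_snd : Measurable (Prod.snd : ℝ × ℝ → ℝ))
      unfold Function.uncurry
      exact (Measurable.mul (by fun_prop) this).mul (by fun_prop)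
    · have : ∀ᵐ z ∂((volume.restrict (uIoc ν (ν + k))).prod (volume.restrict (Ioi (0 : ℝ)))),
          z.2 ∈ Ioi (0 : ℝ) := by
        rw [Measure.prod_restrict]
        filter_upwards [ae_restrict_mem (measurableSet_uIoc.prod measurableSet_Ioi)] with z hz
        exact hz.2
      filter_upwards [this] with z hz
      simp only [Function.uncurry]
      rw [one_mul, norm_mul]
      calc _ ≤ z.2 * boseKernel (ω / α) z.2 * 1 :=
            mul_le_mul (abs_cos_mul_boseKernel_le hc hz _) (Real.abs_cos_le_one _) (abs_nonneg _)
              (mul_pos hz (boseKernel_pos hc hz)).le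
        _ = _ := mul_one _
  have hl : ∀ s, bosePsiDeriv α s * Real.cos (ω * (s - ν)) = 2 * ω ^ 2 * ∫ t in Ioi (0 : ℝ),
      Real.cos (ω * s * t) * (t * boseKernel (ω / α) t) * Real.cos (ω * (s - ν)) := by
    intro s
    rw [bosePsiDeriv_scale α s hω, integral_mul_const]
    ring
  simp_rw [hl]
  rw [intervalIntegral.integral_const_mul, hswap]
  -- Here t²/(1-t²) = 1/(1-t²) - 1. The singular parts subtracted in the two `pvTerm`s cancel by
  -- periodicity, and the -1 yields the sine transforms that become Ψ(ν) and Ψ(ν+k).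
  have hae : (fun t => ∫ s in ν..(ν + k),
      Real.cos (ω * s * t) * (t * boseKernel (ω / α) t) * Real.cos (ω * (s - ν)))
      =ᵐ[volume.restrict (Ioi 0)] fun t => 1 / ω *
        (pvTerm (ω * ν) (ω / α) t - pvTerm (ω * (ν + k)) (ω / α) t -
        (Real.sin (ω * ν * t) * boseKernel (ω / α) t -
          Real.sin (ω * (ν + k) * t) * boseKernel (ω / α) t)) := by
    filter_upwards [ae_restrict_mem measurableSet_Ioi,
      (measure_eq_zero_iff_ae_notMem.1 (measure_singleton (1 : ℝ)) :
        ∀ᵐ t ∂(volume.restrict (Ioi (0 : ℝ))), t ∉ ({1} : Set ℝ))] with t ht h1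
    have h1' : t ≠ 1 := h1
    have ht' : 0 < t := ht
    have h : 1 - t ^ 2 ≠ 0 := by
      rw [show 1 - t ^ 2 = (1 - t) * (1 + t) by ring]
      exact mul_ne_zero (sub_ne_zero.2 h1'.symm) (by linarith)
    have e : ∀ s, Real.cos (ω * s * t) * (t * boseKernel (ω / α) t) * Real.cos (ω * (s - ν)) =
        t * boseKernel (ω / α) t * (Real.cos (ω * s * t) * Real.cos (ω * (s - ν))) := by
      intro s; ring
    simp_rw [e]
    rw [intervalIntegral.integral_const_mul, integral_cos_mul_cos hω ht' h1' k
      (cos_freq_mul_nat n k) (sin_freq_mul_nat n k)]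
    unfold pvTerm
    rw [show Real.sin (ω * (ν + k)) = Real.sin (ω * ν) from sin_freq_mul_add_nat n k ν]
    field_simp
    ring
  have i1 := integrableOn_pvTerm (ω * ν) hc
  have i2 := integrableOn_pvTerm (ω * (ν + k)) hc
  have i3 := integrableOn_sin_mul_boseKernel (ω * ν) hc
  have i4 := integrableOn_sin_mul_boseKernel (ω * (ν + k)) hc
  rw [integral_congr_ae hae, integral_const_mul, integral_sub, integral_sub i1 i2,
    integral_sub i3 i4, bosePsi_scale α ν hω, bosePsi_scale α (ν + k) hω]
  · unfold pvCoeff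
    rw [← hωd]
    field_simp
    ring
  · exact i1.sub i2
  · exact i3.sub i4

/-- The shift runs through integers so that cos(ω(ν+k)) in `integral_pvSin` stays fixed; the
Dirichlet integral then gives the π/2 term. -/
lemma tendsto_pvCoeff_add_nat {α : ℝ} (hα : 0 < α) (ν : ℝ) (n : ℕ) :
    Tendsto (fun k : ℕ => pvCoeff α (ν + k) n) atTop (𝓝 (Real.pi * α / (2 * freq n) -
      boseKernel (freq n / α) 1 * Real.cos (freq n * ν) * (Real.pi / 2))) := by
  have hω := freq_pos n
  set ω := freq n with hωd
  have hc : 0 < ω / α := div_pos hω hα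
  have hk : Tendsto (fun k : ℕ => ν + (k : ℝ)) atTop atTop :=
    tendsto_atTop_add_const_left _ _ tendsto_natCast_atTop_atTop
  have hk2 : Tendsto (fun k : ℕ => ω * (ν + (k : ℝ))) atTop atTop := hk.const_mul_atTop hω
  have h1 : Tendsto (fun k : ℕ => ∫ t in Ioi (0 : ℝ),
      Real.sin (ω * (ν + k) * t) * boseKernel (ω / α) t) atTop
      (𝓝 (Real.pi * α / (2 * ω))) := by
    have := ((tendsto_bosePsi hα).comp hk).div_const (2 * ω)
    refine this.congr fun k => ?_
    simp only [Function.comp]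
    rw [bosePsi_scale α (ν + k) hω]
    field_simp
  have h2 : Tendsto (fun k : ℕ => ∫ t in Ioi (0 : ℝ),
      boseRem (ω / α) t * Real.sin (ω * (ν + k) * t)) atTop (𝓝 0) := by
    have hi : Integrable ((Ioi (0 : ℝ)).indicator (boseRem (ω / α))) :=
      (integrable_indicator_iff measurableSet_Ioi).2 (integrableOn_boseRem hc)
    refine ((tendsto_integral_mul_sin hi).comp hk2).congr fun k => ?_
    simp only [Function.comp]
    rw [← integral_indicator measurableSet_Ioi]
    congr 1 with t
    by_cases h : t ∈ Ioi (0 : ℝ)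
    · rw [indicator_of_mem h, indicator_of_mem h]
    · rw [indicator_of_notMem h, indicator_of_notMem h, zero_mul]
  have h3 : Tendsto (fun k : ℕ => ∫ t in Ioi (0 : ℝ), pvSin (ω * (ν + k)) t) atTop
      (𝓝 (-Real.cos (ω * ν) * (Real.pi / 2))) := by
    refine ((tendsto_integral_sin_div.comp hk2).const_mul (-Real.cos (ω * ν))).congr fun k => ?_
    rw [integral_pvSin, cos_freq_mul_add_nat]
    rfl
  have h := (h1.add h2).add (h3.const_mul (boseKernel (ω / α) 1))
  rw [show Real.pi * α / (2 * ω) - boseKernel (ω / α) 1 * Real.cos (ω * ν) * (Real.pi / 2) =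
    Real.pi * α / (2 * ω) + 0 + boseKernel (ω / α) 1 * (-Real.cos (ω * ν) * (Real.pi / 2)) by ring]
  refine h.congr fun k => ?_
  rw [← integral_pvTerm _ hc]
  rfl

/-- The Euler–Maclaurin remainder at frequency `2π(n+1)`. -/
noncomputable def emRem (α ν : ℝ) (n : ℕ) : ℝ :=
  bosePsi α ν + ∫ s in Ioi ν, bosePsiDeriv α s * Real.cos (freq n * (s - ν))

lemma integrableOn_bosePsiDeriv_mul_cos {α : ℝ} (hα : 0 < α) (ν μ b : ℝ) :
    IntegrableOn (fun s => bosePsiDeriv α s * Real.cos (b * (s - ν))) (Ioi μ) :=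
  (integrableOn_bosePsiDeriv hα μ).mul_bdd (c := 1) (by fun_prop)
    (ae_of_all _ fun t => Real.abs_cos_le_one _)

/-- The limit k → ∞ of `integral_bosePsiDeriv_mul_cos`. -/
lemma emRem_eq {α : ℝ} (hα : 0 < α) (ν : ℝ) (n : ℕ) :
    emRem α ν n = 2 * freq n * pvCoeff α ν n +
      freq n * Real.pi * (boseKernel (freq n / α) 1 * Real.cos (freq n * ν)) := by
  have hω := freq_pos n
  have hk : Tendsto (fun k : ℕ => ν + (k : ℝ)) atTop atTop :=
    tendsto_atTop_add_const_left _ _ tendsto_natCast_atTop_atTop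
  have h1 := intervalIntegral_tendsto_integral_Ioi ν
    (integrableOn_bosePsiDeriv_mul_cos hα ν ν (freq n)) hk
  simp_rw [integral_bosePsiDeriv_mul_cos hα] at h1
  have h2 := ((((tendsto_pvCoeff_add_nat hα ν n).const_sub (pvCoeff α ν n)).const_mul
    (2 * freq n)).add ((tendsto_bosePsi hα).comp hk)).sub_const (bosePsi α ν)
  unfold emRem
  rw [tendsto_nhds_unique h1 h2]
  field_simp
  ring

lemma hasSum_emRem {α : ℝ} (hα : 0 < α) (ν : ℝ) :
    HasSum (fun n => 2 / freq n ^ 2 * emRem α ν n) (-bigM α ν) := by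
  obtain ⟨v, hv, hpv⟩ := hasSum_pvCoeff ν hα
  have h := (summable_cosTerm ν hα).hasSum.add (hv.mul_left (2 / Real.pi))
  unfold bigM
  rw [hpv.pvIntegral_eq, show -(-(∑' n, cosTerm α ν n) - 2 / Real.pi * v) =
    (∑' n, cosTerm α ν n) + 2 / Real.pi * v by ring]
  refine h.congr_fun fun n => ?_
  rw [emRem_eq hα, cosTerm_eq]
  have hω := freq_pos n
  have e : (1 : ℝ) / (n + 1) = 2 * Real.pi / freq n := by unfold freq; field_simp
  rw [e]
  field_simp
  ring

/-! ### Limit and difference equation of M. -/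

lemma hasSum_two_div_freq_sq_mul_cos {x : ℝ} (hx : x ∈ Icc (0 : ℝ) 1) :
    HasSum (fun n => 2 / freq n ^ 2 * Real.cos (freq n * x)) ((x ^ 2 - x + 6⁻¹) / 2) := by
  have h := hasSum_one_div_nat_pow_mul_cos one_ne_zero hx
  have hB : (Polynomial.map (algebraMap ℚ ℝ) (Polynomial.bernoulli (2 * 1))).eval x =
      x ^ 2 - x + 6⁻¹ := bernoulliFun_two x
  rw [hB] at h
  have h2 := ((hasSum_nat_add_iff' 1).2 h).mul_left (2 / (2 * Real.pi) ^ 2)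
  have hv : (x ^ 2 - x + 6⁻¹) / 2 = 2 / (2 * Real.pi) ^ 2 *
      ((-1 : ℝ) ^ (1 + 1) * (2 * Real.pi) ^ (2 * 1) / 2 / ((2 * 1).factorial : ℝ) *
        (x ^ 2 - x + 6⁻¹) - ∑ i ∈ Finset.range 1, 1 / (i : ℝ) ^ (2 * 1) *
          Real.cos (2 * Real.pi * i * x)) := by
    simp [Nat.factorial]
    field_simp
  rw [hv]
  refine h2.congr_fun fun n => ?_
  unfold freq
  push_cast
  field_simp

lemma hasSum_two_div_freq_sq : HasSum (fun n => 2 / freq n ^ 2) (1 / 12) := by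
  have h := hasSum_two_div_freq_sq_mul_cos (x := 0) (by simp)
  norm_num at h
  exact h

/-- As Ψ' ≥ 0 beyond ν ≥ 0, each cosine integral is at most ∫Ψ' = πα - Ψ(ν) in absolute value, and
the weights sum to 1/12. -/
lemma abs_bigM_add_le {α ν : ℝ} (hα : 0 < α) (hν : 0 ≤ ν) :
    |bigM α ν + bosePsi α ν / 12| ≤ (Real.pi * α - bosePsi α ν) / 12 := by
  have h1 := (hasSum_emRem hα ν).sub (hasSum_two_div_freq_sq.mul_right (bosePsi α ν))
  have h2 : ∀ n, ‖2 / freq n ^ 2 * emRem α ν n - 2 / freq n ^ 2 * bosePsi α ν‖ ≤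
      2 / freq n ^ 2 * (Real.pi * α - bosePsi α ν) := by
    intro n
    have hω := freq_pos n
    rw [← mul_sub, norm_mul, Real.norm_of_nonneg (by positivity)]
    refine mul_le_mul_of_nonneg_left ?_ (by positivity)
    unfold emRem
    rw [add_sub_cancel_left, ← integral_Ioi_bosePsiDeriv hα ν]
    refine norm_integral_le_of_norm_le (integrableOn_bosePsiDeriv hα ν) ?_
    filter_upwards [ae_restrict_mem measurableSet_Ioi] with s hs
    have h3 := bosePsiDeriv_nonneg hα (lt_of_le_of_lt hν hs)
    rw [norm_mul, Real.norm_of_nonneg h3]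
    exact mul_le_of_le_one_right h3 (Real.abs_cos_le_one _)
  have h4 := (hasSum_two_div_freq_sq.mul_right (Real.pi * α - bosePsi α ν))
  have h5 := tsum_of_norm_bounded h4 h2
  rw [h1.tsum_eq, Real.norm_eq_abs, ← abs_neg] at h5
  calc _ = |-(-bigM α ν - 1 / 12 * bosePsi α ν)| := by congr 1; ring
    _ ≤ _ := h5
    _ = _ := by ring

lemma tendsto_bigM {α : ℝ} (hα : 0 < α) :
    Tendsto (bigM α) atTop (𝓝 (-(Real.pi / 12 * α))) := by
  have h0 : Tendsto (fun ν => (Real.pi * α - bosePsi α ν) / 12) atTop (𝓝 0) := by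
    have := ((tendsto_bosePsi hα).const_sub (Real.pi * α)).div_const 12
    simpa using this
  have h1 : Tendsto (fun ν => bigM α ν + bosePsi α ν / 12) atTop (𝓝 0) := by
    refine squeeze_zero_norm' ?_ h0
    filter_upwards [eventually_ge_atTop 0] with ν hν
    exact abs_bigM_add_le hα hν
  have h2 := h1.sub ((tendsto_bosePsi hα).div_const 12)
  rw [show -(Real.pi / 12 * α) = 0 - Real.pi * α / 12 by ring]
  exact h2.congr fun ν => by ring

lemma emRem_sub_emRem_add_one {α : ℝ} (hα : 0 < α) (ν : ℝ) (n : ℕ) :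
    emRem α ν n - emRem α (ν + 1) n = bosePsi α ν - bosePsi α (ν + 1) +
      ∫ s in ν..(ν + 1), bosePsiDeriv α s * Real.cos (freq n * (s - ν)) := by
  have h1 : ∀ s, Real.cos (freq n * (s - (ν + 1))) = Real.cos (freq n * (s - ν)) := by
    intro s
    rw [← cos_freq_mul_add_nat n 1 (s - (ν + 1))]
    congr 2; push_cast; ring
  have h2 := intervalIntegral.integral_Ioi_sub_Ioi
    (integrableOn_bosePsiDeriv_mul_cos hα ν ν (freq n))
    (show ν ≤ ν + 1 by linarith)
  unfold emRem
  simp_rw [h1]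
  rw [← h2]
  ring

/-- The terms combine under the integral into Ψ' times half the second Bernoulli polynomial of s -
ν. Two integrations by parts give the trapezoidal error; the boundary terms Ψ/12 cancel. -/
lemma bigM_add_one_sub {α : ℝ} (hα : 0 < α) {Λ : ℝ → ℝ}
    (hΛ : ∀ s, HasDerivAt Λ (bosePsi α s) s) (ν : ℝ) :
    bigM α (ν + 1) - bigM α ν = (∫ s in ν..(ν + 1), Λ s) - (Λ ν + Λ (ν + 1)) / 2 := by
  have hcΛ : Continuous Λ := continuous_iff_continuousAt.2 fun s => (hΛ s).continuousAt
  have hcd := continuous_bosePsiDeriv hα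
  have h1 := (hasSum_emRem hα ν).sub (hasSum_emRem hα (ν + 1))
  have hle : ν ≤ ν + 1 := by linarith
  have h2 : HasSum (fun n => ∫ s in ν..(ν + 1), 2 / freq n ^ 2 *
      (bosePsiDeriv α s * Real.cos (freq n * (s - ν))))
      (∫ s in ν..(ν + 1), bosePsiDeriv α s * (((s - ν) ^ 2 - (s - ν) + 6⁻¹) / 2)) := by
    refine intervalIntegral.hasSum_integral_of_dominated_convergence
      (fun n s => 2 / freq n ^ 2 * |bosePsiDeriv α s|) (fun n => ?_) (fun n => ?_) ?_ ?_ ?_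
    · exact Continuous.aestronglyMeasurable (by fun_prop)
    · refine ae_of_all _ fun s _ => ?_
      have hω := freq_pos n
      rw [norm_mul, Real.norm_of_nonneg (by positivity), norm_mul]
      refine mul_le_mul_of_nonneg_left ?_ (by positivity)
      exact mul_le_of_le_one_right (norm_nonneg _) (Real.abs_cos_le_one _)
    · exact ae_of_all _ fun s _ => hasSum_two_div_freq_sq.summable.mul_right _
    · simp_rw [tsum_mul_right]
      exact Continuous.intervalIntegrable (by fun_prop) _ _
    · refine ae_of_all _ fun s hs => ?_
      rw [uIoc_of_le hle] at hs
      have := (hasSum_two_div_freq_sq_mul_cos (x := s - ν)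
        ⟨by linarith [hs.1], by linarith [hs.2]⟩).mul_left (bosePsiDeriv α s)
      exact this.congr_fun fun n => by ring
  have h3 := (hasSum_two_div_freq_sq.mul_right (bosePsi α ν - bosePsi α (ν + 1))).add h2
  have h4 := h1.unique (h3.congr_fun fun n => by
    rw [← mul_sub, emRem_sub_emRem_add_one hα, intervalIntegral.integral_const_mul]; ring)
  -- Both integrations by parts at once, in a single antiderivative.
  have hder : ∀ s ∈ uIcc ν (ν + 1), HasDerivAt
      (fun s => bosePsi α s * (((s - ν) ^ 2 - (s - ν) + 6⁻¹) / 2) - Λ s * (2 * (s - ν) - 1) / 2)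
      (bosePsiDeriv α s * (((s - ν) ^ 2 - (s - ν) + 6⁻¹) / 2) - Λ s) s := by
    intro s _
    have e0 : HasDerivAt (fun s => s - ν) 1 s := (hasDerivAt_id s).sub_const ν
    have e1 := (((e0.pow 2).sub e0).add_const (6⁻¹ : ℝ)).div_const 2
    have e2 := (hΛ s).mul (((e0.const_mul 2).sub_const 1))
    refine (((hasDerivAt_bosePsi hα s).mul e1).sub (e2.div_const 2)).congr_deriv ?_
    simp
    ring
  have h5 := intervalIntegral.integral_eq_sub_of_hasDerivAt hder
    (Continuous.intervalIntegrable (by fun_prop) _ _)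
  rw [intervalIntegral.integral_sub (Continuous.intervalIntegrable (by fun_prop) _ _)
    (hcΛ.intervalIntegrable _ _)] at h5
  rw [add_sub_cancel_left, sub_self] at h5
  linarith

/-! ### The primitive of Ψ: log `expQuot` across its removable singularity. -/

lemma expQuot_of_ne {α ν : ℝ} (h : ν ≠ 0) :
    expQuot α ν = (1 - Real.exp (-(2 * Real.pi * α) * ν)) / ν := by
  unfold expQuot
  rw [if_neg h]
  congr 3; ring

lemma expQuot_pos {α : ℝ} (hα : 0 < α) (ν : ℝ) : 0 < expQuot α ν := by
  have ha : 0 < 2 * Real.pi * α := by positivity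
  rcases lt_trichotomy ν 0 with h | h | h
  · rw [expQuot_of_ne h.ne]
    refine div_pos_of_neg_of_neg ?_ h
    rw [sub_neg, Real.one_lt_exp_iff]
    nlinarith
  · unfold expQuot
    rwa [if_pos h]
  · rw [expQuot_of_ne h.ne']
    refine div_pos ?_ h
    rw [sub_pos, Real.exp_lt_one_iff]
    nlinarith

lemma hasDerivAt_log_expQuot_of_ne {α s : ℝ} (hα : 0 < α) (hs : s ≠ 0) :
    HasDerivAt (fun s => Real.log (expQuot α s)) (bosePsi α s - Real.pi * α) s := by
  set a := 2 * Real.pi * α with ha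
  have hpos := expQuot_pos hα s
  have e1 : HasDerivAt (fun s => 1 - Real.exp (-a * s)) (-(Real.exp (-a * s) * (-a))) s := by
    simpa using (((hasDerivAt_id s).const_mul (-a)).exp).const_sub 1
  have e2 := e1.div (hasDerivAt_id s) hs
  have e3 : HasDerivAt (expQuot α) _ s := e2.congr_of_eventuallyEq (by
    filter_upwards [eventually_ne_nhds hs] with x hx
    rw [expQuot_of_ne hx]; rfl)
  refine (e3.log hpos.ne').congr_deriv ?_
  rw [bosePsi_eq hα hs]
  rw [expQuot_of_ne hs, ← ha]
  have hE : Real.exp (-a * s) = (Real.exp (a * s))⁻¹ := by rw [← Real.exp_neg]; congr 1; ring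
  have hne : Real.exp (a * s) - 1 ≠ 0 := by
    rw [sub_ne_zero, Ne, Real.exp_eq_one_iff]; positivity
  have he := (Real.exp_pos (a * s)).ne'
  rw [hE]
  generalize Real.exp (a * s) = w at hne he ⊢
  have hw2 : 1 - w⁻¹ ≠ 0 := by
    intro h
    field_simp at h
    exact hne (by simpa using h)
  simp only [id]
  field_simp
  ring

lemma continuousAt_log_expQuot_zero {α : ℝ} (hα : 0 < α) :
    ContinuousAt (fun s => Real.log (expQuot α s)) 0 := by
  refine ContinuousAt.log ?_ (expQuot_pos hα 0).ne'
  have e1 : HasDerivAt (fun s => 1 - Real.exp (-(2 * Real.pi * α) * s)) (2 * Real.pi * α) 0 := by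
    simpa using (((hasDerivAt_id (0 : ℝ)).const_mul (-(2 * Real.pi * α))).exp).const_sub 1
  have e2 := (hasDerivAt_iff_tendsto_slope_zero.1 e1)
  rw [continuousAt_iff_punctured_nhds]
  unfold expQuot
  rw [if_pos rfl]
  refine e2.congr' ?_
  filter_upwards [self_mem_nhdsWithin] with s hs
  rw [if_neg (show s ≠ 0 from hs)]
  simp only [zero_add, mul_zero, Real.exp_zero, sub_self, sub_zero, smul_eq_mul]
  rw [inv_mul_eq_div]
  congr 3; ring

lemma hasDerivAt_log_expQuot {α : ℝ} (hα : 0 < α) (s : ℝ) :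
    HasDerivAt (fun s => Real.log (expQuot α s)) (bosePsi α s - Real.pi * α) s := by
  rcases eq_or_ne s 0 with rfl | hs
  · refine hasDerivAt_of_hasDerivAt_of_ne
      (g := fun s => bosePsi α s - Real.pi * α)
      (fun y hy => hasDerivAt_log_expQuot_of_ne hα hy) (continuousAt_log_expQuot_zero hα) ?_
    exact ((continuous_bosePsi hα).sub continuous_const).continuousAt
  · exact hasDerivAt_log_expQuot_of_ne hα hs

lemma bernIntegrand_eq {α : ℝ} (hα : 0 < α) (t : ℝ) :
    bernIntegrand α t = t * (bosePsi α t - Real.pi * α) := by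
  unfold bernIntegrand
  split_ifs with h
  · rw [h, zero_mul]
  · rw [bosePsi_eq hα h]
    have hne : Real.exp (2 * Real.pi * α * t) - 1 ≠ 0 := by
      rw [sub_ne_zero, Ne, Real.exp_eq_one_iff]; positivity
    field_simp
    ring

lemma continuous_bernIntegrand {α : ℝ} (hα : 0 < α) : Continuous (bernIntegrand α) := by
  rw [funext (bernIntegrand_eq hα)]
  exact continuous_id.mul ((continuous_bosePsi hα).sub continuous_const)

lemma continuous_log_expQuot {α : ℝ} (hα : 0 < α) :
    Continuous (fun s => Real.log (expQuot α s)) :=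
  continuous_iff_continuousAt.2 fun s => (hasDerivAt_log_expQuot hα s).continuousAt

/-- Integration by parts, since `bernIntegrand` is t times the derivative of log `expQuot`. -/
lemma integral_bernIntegrand {α : ℝ} (hα : 0 < α) (ν : ℝ) :
    ∫ t in (0 : ℝ)..ν, bernIntegrand α t =
      ν * Real.log (expQuot α ν) - ∫ t in (0 : ℝ)..ν, Real.log (expQuot α t) := by
  have hc := continuous_log_expQuot hα
  have hd : ∀ t ∈ uIcc 0 ν, HasDerivAt (fun t => t * Real.log (expQuot α t))
      (bernIntegrand α t + Real.log (expQuot α t)) t := fun t _ => by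
    refine ((hasDerivAt_id t).mul (hasDerivAt_log_expQuot hα t)).congr_deriv ?_
    rw [bernIntegrand_eq hα]
    simp only [id]
    ring
  have h := intervalIntegral.integral_eq_sub_of_hasDerivAt hd
    (((continuous_bernIntegrand hα).add hc).intervalIntegrable _ _)
  rw [intervalIntegral.integral_add ((continuous_bernIntegrand hα).intervalIntegrable _ _)
    (hc.intervalIntegrable _ _)] at h
  linarith

/-! ### Difference equation of the closed expression. -/

/-- The closed expression for `log (x; q)_∞`. -/
noncomputable def logPochExpr (α ν : ℝ) : ℝ :=
  -(Real.pi / (12 * α)) + Real.log (Real.sqrt (2 * Real.pi) / Real.Gamma (ν + 1))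
    + Real.pi / 12 * α - (ν + 1 / 2) * Real.log (expQuot α ν)
    + (∫ t in (0 : ℝ)..ν, bernIntegrand α t) + bigM α ν

lemma log_sqrt_two_pi_div_Gamma {y : ℝ} (hy : 0 < y) :
    Real.log (Real.sqrt (2 * Real.pi) / Real.Gamma y) =
      Real.log (Real.sqrt (2 * Real.pi)) - Real.log (Real.Gamma y) :=
  Real.log_div (by positivity) (Real.Gamma_pos_of_pos hy).ne'

lemma log_Gamma_add_one {y : ℝ} (hy : 0 < y) :
    Real.log (Real.Gamma (y + 1)) = Real.log y + Real.log (Real.Gamma y) := by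
  rw [Real.Gamma_add_one hy.ne', Real.log_mul hy.ne' (Real.Gamma_pos_of_pos hy).ne']

lemma log_expQuot {α s : ℝ} (hα : 0 < α) (hs : 0 < s) :
    Real.log (expQuot α s) = Real.log (1 - Real.exp (-(2 * Real.pi * α) * s)) - Real.log s := by
  have h := expQuot_pos hα s
  rw [expQuot_of_ne hs.ne'] at h ⊢
  exact Real.log_div (fun h0 => by rw [h0, zero_div] at h; exact lt_irrefl _ h) hs.ne'

lemma logPochExpr_sub_add_one {α ν : ℝ} (hα : 0 < α) (hν : -1 < ν) :
    logPochExpr α ν - logPochExpr α (ν + 1) =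
      Real.log (1 - Real.exp (-(2 * Real.pi * α) * (ν + 1))) := by
  have hc := continuous_log_expQuot hα
  have hΛ : ∀ s, HasDerivAt (fun s => Real.log (expQuot α s) + Real.pi * α * s)
      (bosePsi α s) s := fun s => by
    refine ((hasDerivAt_log_expQuot hα s).add ((hasDerivAt_id s).const_mul
      (Real.pi * α))).congr_deriv ?_
    ring
  have h1 := bigM_add_one_sub hα hΛ ν
  rw [intervalIntegral.integral_add (hc.intervalIntegrable _ _)
    (Continuous.intervalIntegrable (by fun_prop) _ _), intervalIntegral.integral_const_mul,
    integral_id] at h1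
  have hy : 0 < ν + 1 := by linarith
  have h2 := intervalIntegral.integral_add_adjacent_intervals
    (hc.intervalIntegrable (μ := volume) 0 ν) (hc.intervalIntegrable (μ := volume) ν (ν + 1))
  have h3 := log_expQuot hα hy
  unfold logPochExpr
  rw [log_sqrt_two_pi_div_Gamma hy, log_sqrt_two_pi_div_Gamma (by linarith),
    log_Gamma_add_one hy, integral_bernIntegrand hα, integral_bernIntegrand hα, ← h2]
  -- After the parts formula only -½ log `expQuot` and an integral of it remain: the trapezoidal
  -- error. The linear part παs of Λ contributes none.
  linear_combination h3 - h1

/-! ### Stirling's formula and the limit of the closed expression. -/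

lemma log_Gamma_add_nat {y : ℝ} (hy : 0 < y) (n : ℕ) :
    Real.log (Real.Gamma (y + n)) =
      Real.log (Real.Gamma y) + ∑ m ∈ Finset.range n, Real.log (y + m) := by
  induction n with
  | zero => simp
  | succ n ih =>
    rw [Finset.sum_range_succ, Nat.cast_succ, ← add_assoc, log_Gamma_add_one (by positivity), ih]
    ring

lemma tendsto_log_factorial_stirling :
    Tendsto (fun n : ℕ => Real.log (n.factorial) - (n + 1 / 2) * Real.log n + n) atTop
      (𝓝 (Real.log (Real.sqrt (2 * Real.pi)))) := by
  have h := ((Real.continuousAt_log (by positivity : Real.sqrt Real.pi ≠ 0)).tendsto.comp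
    Stirling.tendsto_stirlingSeq_sqrt_pi).add_const (1 / 2 * Real.log 2)
  have hv : Real.log (Real.sqrt Real.pi) + 1 / 2 * Real.log 2 =
      Real.log (Real.sqrt (2 * Real.pi)) := by
    rw [Real.log_sqrt (by positivity), Real.log_sqrt (by positivity),
      Real.log_mul (by norm_num) (by positivity)]
    ring
  rw [hv] at h
  refine h.congr' ?_
  filter_upwards [eventually_gt_atTop 0] with n hn
  have hn' : (0 : ℝ) < n := Nat.cast_pos.2 hn
  simp only [Function.comp]
  rw [Stirling.log_stirlingSeq_formula, Real.log_mul (by norm_num) hn'.ne',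
    Real.log_div hn'.ne' (Real.exp_pos 1).ne', Real.log_exp]
  ring

/-- Stirling for factorials is carried to the shift ν by the Euler limit for log Γ(ν+1); the change
from log n to log(ν+n+1) costs the limits `h3` and `h4`. -/
lemma tendsto_log_Gamma_stirling {ν : ℝ} (hν : -1 < ν) :
    Tendsto (fun n : ℕ => Real.log (Real.Gamma (ν + (n + 1) + 1)) -
      (ν + (n + 1) + 1 / 2) * Real.log (ν + (n + 1)) + (ν + (n + 1))) atTop
      (𝓝 (Real.log (Real.sqrt (2 * Real.pi)))) := by
  have hy : 0 < ν + 1 := by linarith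
  have h1 := (Real.BohrMollerup.tendsto_log_gamma hy).const_sub (Real.log (Real.Gamma (ν + 1)))
  rw [sub_self] at h1
  have h2 := tendsto_log_factorial_stirling
  have h3 : Tendsto (fun n : ℕ => (n : ℝ) * Real.log (1 + (ν + 1) / n)) atTop (𝓝 (ν + 1)) :=
    (Real.tendsto_mul_log_one_add_div_atTop (ν + 1)).comp tendsto_natCast_atTop_atTop
  have h4 : Tendsto (fun n : ℕ => Real.log (1 + (ν + 1) / n)) atTop (𝓝 0) := by
    have h : Tendsto (fun n : ℕ => 1 + (ν + 1) / (n : ℝ)) atTop (𝓝 (1 + 0)) :=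
      (tendsto_const_nhds.div_atTop tendsto_natCast_atTop_atTop).const_add 1
    rw [add_zero] at h
    have := (Real.continuousAt_log one_ne_zero).tendsto.comp h
    rwa [Real.log_one] at this
  have h := ((h1.add h2).sub (h3.add (h4.const_mul (ν + 3 / 2)))).add_const (ν + 1)
  rw [mul_zero, zero_add, add_zero, sub_add_cancel] at h
  refine h.congr' ?_
  filter_upwards [eventually_gt_atTop 0] with n hn
  have hn' : (0 : ℝ) < n := Nat.cast_pos.2 hn
  have e1 : Real.log (1 + (ν + 1) / n) = Real.log (ν + (n + 1)) - Real.log n := by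
    rw [← Real.log_div (by linarith) hn'.ne']
    congr 1
    field_simp
    ring
  have e2 := log_Gamma_add_nat hy (n + 1)
  rw [show ν + 1 + ((n + 1 : ℕ) : ℝ) = ν + (n + 1) + 1 by push_cast; ring] at e2
  rw [e1, e2]
  unfold Real.BohrMollerup.logGammaSeq
  ring

/-- Adding x cancels the -1 in the integrand; what remains is the first moment of the kernel,
evaluated by ζ(2). -/
lemma tendsto_integral_bernIntegrand {α : ℝ} (hα : 0 < α) :
    Tendsto (fun x : ℝ => (∫ t in (0 : ℝ)..x, bernIntegrand α t) + x) atTop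
      (𝓝 (Real.pi / (12 * α))) := by
  have ha : 0 < 2 * Real.pi * α := by positivity
  have hI := integrableOn_self_mul_boseKernel ha
  have h := (intervalIntegral_tendsto_integral_Ioi 0 hI tendsto_id).const_mul (2 * Real.pi * α)
  rw [integral_id_mul_boseKernel ha, show 2 * Real.pi * α * (Real.pi ^ 2 /
    (6 * (2 * Real.pi * α) ^ 2)) = Real.pi / (12 * α) by field_simp; norm_num] at h
  refine h.congr' ?_
  filter_upwards [eventually_ge_atTop 0] with x hx
  have h1 : ∫ t in (0 : ℝ)..x, (bernIntegrand α t + 1) =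
      (∫ t in (0 : ℝ)..x, bernIntegrand α t) + x := by
    rw [intervalIntegral.integral_add ((continuous_bernIntegrand hα).intervalIntegrable _ _)
      (Continuous.intervalIntegrable (by fun_prop) _ _)]
    simp
  rw [← h1, ← intervalIntegral.integral_const_mul, id, intervalIntegral.integral_of_le hx,
    intervalIntegral.integral_of_le hx]
  refine setIntegral_congr_fun measurableSet_Ioc fun t ht => ?_
  simp only [bernIntegrand, boseKernel]
  rw [if_neg ht.1.ne']
  ring

lemma tendsto_mul_log_one_sub_exp {a : ℝ} (ha : 0 < a) :
    Tendsto (fun x : ℝ => (x + 1 / 2) * Real.log (1 - Real.exp (-a * x))) atTop (𝓝 0) := by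
  have h0 : Tendsto (fun x : ℝ => 2 * (1 / a * Real.exp (-(a / 2) * x))) atTop (𝓝 0) := by
    have := (((Real.tendsto_exp_atBot.comp (tendsto_id.const_mul_atTop_of_neg
      (by linarith : -(a / 2) < 0))).const_mul (1 / a)).const_mul 2)
    simpa using this
  refine squeeze_zero_norm' ?_ h0
  filter_upwards [eventually_ge_atTop 1] with x hx
  have hx0 : 0 < x := by linarith
  have hw := exp_sub_one_pos (mul_pos ha hx0)
  have hlt : Real.exp (-a * x) < 1 := Real.exp_lt_one_iff.2 (by nlinarith)
  have hl0 : Real.log (1 - Real.exp (-a * x)) ≤ 0 :=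
    Real.log_nonpos (by linarith) (by linarith [Real.exp_pos (-a * x)])
  -- From log y ≤ y - 1 at y = 1/(1 - e^{-ax}).
  have hl1 : -Real.log (1 - Real.exp (-a * x)) ≤ boseKernel a x := by
    rw [← Real.log_inv]
    refine (Real.log_le_sub_one_of_pos (inv_pos.2 (by linarith))).trans (le_of_eq ?_)
    have hE : Real.exp (-a * x) = (Real.exp (a * x))⁻¹ := by rw [← Real.exp_neg]; congr 1; ring
    have he := Real.exp_pos (a * x)
    unfold boseKernel
    rw [hE]
    field_simp
    ring
  have hH := boseKernel_pos ha hx0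
  rw [norm_mul, Real.norm_of_nonneg (by linarith), Real.norm_of_nonpos hl0]
  calc _ ≤ (x + 1 / 2) * boseKernel a x := by gcongr
    _ ≤ 2 * (x * boseKernel a x) := by nlinarith
    _ ≤ _ := by
      have := self_mul_boseKernel_le ha hx0
      linarith

lemma tendsto_logPochExpr {α ν : ℝ} (hα : 0 < α) (hν : -1 < ν) :
    Tendsto (fun n : ℕ => logPochExpr α (ν + ((n + 1 : ℕ) : ℝ))) atTop (𝓝 0) := by
  have ha : 0 < 2 * Real.pi * α := by positivity
  have hx : Tendsto (fun n : ℕ => ν + ((n : ℝ) + 1)) atTop atTop :=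
    tendsto_atTop_add_const_left _ _
      (tendsto_atTop_add_const_right _ _ tendsto_natCast_atTop_atTop)
  have h1 := (tendsto_log_Gamma_stirling hν).const_sub (Real.log (Real.sqrt (2 * Real.pi)))
  have h2 := (tendsto_mul_log_one_sub_exp ha).comp hx
  have h3 := (tendsto_integral_bernIntegrand hα).comp hx
  have h4 := (tendsto_bigM hα).comp hx
  have h := ((((h1.sub h2).add h3).add h4).add_const (-(Real.pi / (12 * α)))).add_const
    (Real.pi / 12 * α)
  rw [show Real.log (Real.sqrt (2 * Real.pi)) - Real.log (Real.sqrt (2 * Real.pi)) - 0 +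
    Real.pi / (12 * α) + -(Real.pi / 12 * α) + -(Real.pi / (12 * α)) + Real.pi / 12 * α = 0 by
      ring] at h
  -- The part (x+½) log x of -(x+½) log `expQuot` and the +x of `h3` are exactly Stirling's terms.
  refine h.congr fun n => ?_
  have hpos : 0 < ν + ((n : ℝ) + 1) := by linarith [Nat.cast_nonneg (α := ℝ) n]
  simp only [Function.comp]
  unfold logPochExpr
  push_cast
  rw [log_sqrt_two_pi_div_Gamma (by linarith), log_expQuot hα hpos]
  ring

lemma logPochExpr_sub_add_nat {α ν : ℝ} (hα : 0 < α) (hν : -1 < ν) (k : ℕ) :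
    ∑ m ∈ Finset.range k, Real.log (1 - Real.exp (-(2 * Real.pi * α) * (ν + m + 1))) =
      logPochExpr α ν - logPochExpr α (ν + k) := by
  induction k with
  | zero => simp
  | succ k ih =>
    rw [Finset.sum_range_succ, ih, ← logPochExpr_sub_add_one hα
      (by linarith [Nat.cast_nonneg (α := ℝ) k]), Nat.cast_succ, ← add_assoc]
    ring

/-! ### Telescoping. -/

theorem theorem2p1 (α ν q x : ℝ) (hα : 0 < α) (hν : -1 < ν)
    (hq : q = Real.exp (-2 * Real.pi * α)) (hx : x = Real.exp (-2 * Real.pi * (1 + ν) * α)) :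
    Multipliable (fun n : ℕ => 1 - x * q ^ n) ∧
    0 < qPoch x q ∧
    Summable (cosTerm α ν) ∧
    (∀ t : ℝ, 0 < t → Summable (sinTerm α ν t)) ∧
    (∃ v : ℝ, HasPVIntegral (singIntegrand α ν) (Set.Ioi 0) 1 v) ∧
    IntervalIntegrable (bernIntegrand α) MeasureTheory.volume 0 ν ∧
    Real.log (qPoch x q) =
      -(Real.pi / (12 * α)) + Real.log (Real.sqrt (2 * Real.pi) / Real.Gamma (ν + 1))
        + Real.pi / 12 * α - (ν + 1 / 2) * Real.log (expQuot α ν)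
        + (∫ t in (0 : ℝ)..ν, bernIntegrand α t) + bigM α ν := by
  have ha : 0 < 2 * Real.pi * α := by positivity
  have hterm : ∀ m : ℕ, x * q ^ m = Real.exp (-(2 * Real.pi * α) * (ν + m + 1)) := by
    intro m
    rw [hq, hx, ← Real.exp_nat_mul, ← Real.exp_add]
    congr 1; ring
  have hq1 : q < 1 := by rw [hq, Real.exp_lt_one_iff]; linarith
  have hpos : ∀ m : ℕ, 0 < 1 - x * q ^ m := by
    intro m
    have : 0 < ν + m + 1 := by linarith [Nat.cast_nonneg (α := ℝ) m]
    rw [hterm, sub_pos, Real.exp_lt_one_iff]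
    nlinarith
  have hs : Summable fun m : ℕ => Real.log (1 - x * q ^ m) := by
    have h := (summable_geometric_of_lt_one (by rw [hq]; positivity) hq1).mul_left (-x)
    refine (Real.summable_log_one_add_of_summable h).congr fun m => ?_
    rw [neg_mul, ← sub_eq_add_neg]
  have hprod : Real.exp (∑' m : ℕ, Real.log (1 - x * q ^ m)) = qPoch x q :=
    Real.rexp_tsum_eq_tprod hpos hs
  have hsum : ∑' m : ℕ, Real.log (1 - x * q ^ m) = logPochExpr α ν := by
    -- Partial sums of n + 1 terms, matching `tendsto_logPochExpr`, where ν + n + 1 > 0 is needed.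
    have h1 := hs.hasSum.tendsto_sum_nat.comp (tendsto_add_atTop_nat 1)
    have h2 := (tendsto_logPochExpr hα hν).const_sub (logPochExpr α ν)
    rw [sub_zero] at h2
    refine tendsto_nhds_unique h1 (h2.congr fun n => ?_)
    simp only [Function.comp, hterm]
    rw [logPochExpr_sub_add_nat hα hν]
  obtain ⟨v, -, hv⟩ := hasSum_pvCoeff ν hα
  refine ⟨Real.multipliable_of_summable_log hpos hs, ?_, summable_cosTerm ν hα,
    fun t ht => summable_sinTerm ν hα ht, ⟨v, hv⟩,
    (continuous_bernIntegrand hα).intervalIntegrable _ _, ?_⟩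
  · rw [← hprod]
    exact Real.exp_pos _
  · rw [← hprod, Real.log_exp, hsum]
    rfl
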